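/- Let $C\subseteq\{0,1\}^m$ be a binary code (equivalently, a set system on $[m]$, each set being identified with its indicator vector). A chain of length $\ell$ in $C$ is a pair of injective maps $a:[\ell]\to[m]$, $c:[\ell]\to C$ such that $c(i)_{a(i)}=1$ for all $i\in[\ell]$ and $c(i)_{a(j)}=0$ for all $1\le i<j\le\ell$; the chain length $\mathrm{CL}(C)$ is the length of the longest chain. For weights $w:[m]\to\mathbb{R}_{\ge0}$ and $\varepsilon>0$, a $(1\pm\varepsilon)$ sparsifier of $C$ is a function $\widetilde w:[m]\to\mathbb{R}_{\ge0}$ such that for every $c\in C$ $$(1-\varepsilon)\sum_{i=1}^m w(i)c_i\;\le\;\sum_{i=1}^m\widetilde w(i)c_i\;\le\;(1+\varepsilon)\sum_{i=1}^m w(i)c_i .$$ Theorem. There is an absolute constant $K>0$ such that for every $m$, every code $C\subseteq\{0,1\}^m$, all weights $w:[m]\to\mathbb{R}_{\ge0}$ and every $\varepsilon>0$, there is a $(1\pm\varepsilon)$ sparsifier $\widetilde w$ of $C$ with $$|\operatorname{supp}(\widetilde w)|\;\le\;K\cdot\frac{\mathrm{CL}(C)\cdot\log^2(X)\cdot(\log\log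 X)^2}{\varepsilon^2},\qquad X:=\max\{4,\ \mathrm{CL}(C)/\varepsilon\}.$$ In particular the bound does not depend on $m$. (When $\mathrm{CL}(C)/\varepsilon\ge4$, one has $X=\mathrm{CL}(C)/\varepsilon$; logarithms are natural.) -/

import Mathlib

open scoped NNReal

/-- A chain of length `ℓ` in the code `C ⊆ {0,1}^m`: injective maps `a : [ℓ] → [m]` and
`c : [ℓ] → C` with `c(i)_{a(i)} = 1` for all `i`, and `c(i)_{a(j)} = 0` for all `i < j`. -/
structure IsCodeChain {m : ℕ} (C : Set (Fin m → Fin 2)) (ℓ : ℕ)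
    (a : Fin ℓ → Fin m) (c : Fin ℓ → (Fin m → Fin 2)) : Prop where
  coord_injective : Function.Injective a
  word_injective : Function.Injective c
  word_mem : ∀ i, c i ∈ C
  diag : ∀ i, c i (a i) = 1
  above_diag : ∀ i j, i < j → c i (a j) = 0

/-- The chain length `CL(C)`: the length of the longest chain in `C`.
The supremum is attained, see `chainLength_isGreatest`. -/
noncomputable def chainLength {m : ℕ} (C : Set (Fin m → Fin 2)) : ℕ :=
  sSup {ℓ : ℕ | ∃ a c, IsCodeChain C ℓ a c}

theorem chainLength_isGreatest {m : ℕ} (C : Set (Fin m → Fin 2)) :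
    IsGreatest {ℓ : ℕ | ∃ a c, IsCodeChain C ℓ a c} (chainLength C) := by
  have hb : BddAbove {ℓ : ℕ | ∃ a c, IsCodeChain C ℓ a c} := by
    refine ⟨m, ?_⟩
    rintro ℓ ⟨a, c, h⟩
    simpa using Fintype.card_le_of_injective a h.coord_injective
  have hne : {ℓ : ℕ | ∃ a c, IsCodeChain C ℓ a c}.Nonempty :=
    ⟨0, fun i => i.elim0, fun i => i.elim0, fun i => i.elim0, fun i => i.elim0,
      fun i => i.elim0, fun i => i.elim0, fun i => i.elim0⟩
  exact ⟨Nat.sSup_mem hne hb, fun ℓ hℓ => le_csSup hb hℓ⟩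

/-- The weight `⟨w, c⟩ = ∑ i, w(i) c_i` of the codeword `c ∈ {0,1}^m`. -/
noncomputable def codewordWeight {m : ℕ} (w : Fin m → ℝ≥0) (c : Fin m → Fin 2) : ℝ :=
  ∑ i, (w i : ℝ) * ((c i : ℕ) : ℝ)

/-- The weights `w'` are a `(1 ± ε)` sparsifier of the code `C` with weights `w`:
`⟨w', c⟩ ∈ (1 ± ε) ⟨w, c⟩` for every codeword `c ∈ C`. -/
def IsCodeSparsifier {m : ℕ} (C : Set (Fin m → Fin 2)) (w : Fin m → ℝ≥0) (ε : ℝ)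
    (w' : Fin m → ℝ≥0) : Prop :=
  ∀ c ∈ C, codewordWeight w' c ∈
    Set.Icc ((1 - ε) * codewordWeight w c) ((1 + ε) * codewordWeight w c)

/-! Identify codewords with their supports, and let `chainHeight F A B` be the longest chain of
words inside `B` relative to `A`. This height is superadditive along `A ⊆ B ⊆ D` and drops whenever
a covered element is deleted, so it plays the role that rank plays in cut sparsification.

Call `A` dense at scale `d` if every `T ⊇ A` has weight at least `d` times its height outside `A`. A
contraction argument in Karger's style then bounds the number of traces `c \ A` of weight at most `a
* d` by a polynomial of degree `O(a)` (`card_light_words_le`). Maximizing `d * height - weight`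
produces dense sets, hence an increasing sequence `A j`, dense at scale `d * 2 ^ j`, whose blocks `A
(j + 1) \ A j` have small weight (`exists_scales`).

Elements of block `j` are sampled at a rate inversely proportional to `2 ^ j`. Chernoff bounds and
the counting lemma control all words at once, and the sample size telescopes to `O(k log k log n /
ε²)`, where `n` bounds the support of `w` and `k` the chain length (`exists_sparsifier_of_card_le`).
Repeating this with geometrically decreasing errors brings `n` down to a polynomial in `k / ε`
(`exists_isApprox_card_le_pow`), and a last round yields `O(k log² X / ε²)`. The factor `(log log
X)²` is only needed to be bounded below. -/

namespace CodeSparsifier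
open Finset

variable {ι : Type*} [DecidableEq ι]

/-! ### Relative chain heights -/

/-- `HasChain F B ℓ A`: there are `ℓ` words of `F` contained in `B`, each of which contains an
element that lies neither in `A` nor in one of the preceding words. -/
def HasChain (F : Finset (Finset ι)) (B : Finset ι) : ℕ → Finset ι → Prop
  | 0, _ => True
  | ℓ + 1, A => ∃ c ∈ F, c ⊆ B ∧ ¬ c ⊆ A ∧ HasChain F B ℓ (A ∪ c)

theorem HasChain.le_card {F : Finset (Finset ι)} {B : Finset ι} {ℓ : ℕ} {A : Finset ι}
    (h : HasChain F B ℓ A) : ℓ ≤ #(B \ A) := by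
  induction ℓ generalizing A with
  | zero => simp
  | succ ℓ ih =>
    obtain ⟨c, -, hcB, hcA, hc⟩ := h
    obtain ⟨i, hi, hiA⟩ := not_subset.1 hcA
    refine Nat.succ_le_of_lt ((ih hc).trans_lt (card_lt_card ?_))
    refine (ssubset_iff_of_subset (sdiff_subset_sdiff le_rfl subset_union_left)).2 ⟨i, ?_, ?_⟩
    · simp [hcB hi, hiA]
    · simp [hi]

theorem HasChain.anti {F : Finset (Finset ι)} {B : Finset ι} {ℓ : ℕ} {A A' : Finset ι}
    (hA : A' ⊆ A) (h : HasChain F B ℓ A) : HasChain F B ℓ A' := by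
  induction ℓ generalizing A A' with
  | zero => trivial
  | succ ℓ ih =>
    obtain ⟨c, hc, hcB, hcA, h⟩ := h
    exact ⟨c, hc, hcB, fun h' => hcA (h'.trans hA), ih (union_subset_union_left hA) h⟩

theorem HasChain.mono {F : Finset (Finset ι)} {B B' : Finset ι} (hB : ∀ c ∈ F, c ⊆ B → c ⊆ B')
    {ℓ : ℕ} {A : Finset ι} (h : HasChain F B ℓ A) : HasChain F B' ℓ A := by
  induction ℓ generalizing A with
  | zero => trivial
  | succ ℓ ih =>
    obtain ⟨c, hc, hcB, hcA, h⟩ := h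
    exact ⟨c, hc, hB c hc hcB, hcA, ih h⟩

theorem HasChain.append {F : Finset (Finset ι)} {A B D : Finset ι} (hAB : A ⊆ B) (hBD : B ⊆ D)
    {ℓ ℓ' : ℕ} (h : HasChain F B ℓ A) (h' : HasChain F D ℓ' B) : HasChain F D (ℓ + ℓ') A := by
  induction ℓ generalizing A with
  | zero => simpa using h'.anti hAB
  | succ ℓ ih =>
    obtain ⟨c, hc, hcB, hcA, h⟩ := h
    rw [Nat.add_right_comm]
    exact ⟨c, hc, hcB.trans hBD, hcA, ih (union_subset hAB hcB) h⟩

/-- The largest length of a chain of words contained in `B`, relative to `A`. -/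
noncomputable def chainHeight (F : Finset (Finset ι)) (A B : Finset ι) : ℕ :=
  sSup {ℓ | HasChain F B ℓ A}

theorem bddAbove_hasChain (F : Finset (Finset ι)) (A B : Finset ι) :
    BddAbove {ℓ | HasChain F B ℓ A} := ⟨_, fun _ h => h.le_card⟩

theorem hasChain_chainHeight (F : Finset (Finset ι)) (A B : Finset ι) :
    HasChain F B (chainHeight F A B) A :=
  Nat.sSup_mem (s := {ℓ | HasChain F B ℓ A}) ⟨0, trivial⟩ (bddAbove_hasChain F A B)

theorem HasChain.le_chainHeight {F : Finset (Finset ι)} {A B : Finset ι} {ℓ : ℕ}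
    (h : HasChain F B ℓ A) : ℓ ≤ chainHeight F A B :=
  le_csSup (bddAbove_hasChain F A B) h

theorem chainHeight_le_card (F : Finset (Finset ι)) (A B : Finset ι) :
    chainHeight F A B ≤ #(B \ A) :=
  (hasChain_chainHeight F A B).le_card

/-- Chains concatenate: the words of a chain inside `B` cannot cover the new elements of a chain
relative to `B`. -/
theorem chainHeight_add_le (F : Finset (Finset ι)) {A B D : Finset ι} (hAB : A ⊆ B)
    (hBD : B ⊆ D) : chainHeight F A B + chainHeight F B D ≤ chainHeight F A D :=
  ((hasChain_chainHeight F A B).append hAB hBD (hasChain_chainHeight F B D)).le_chainHeight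

theorem chainHeight_anti (F : Finset (Finset ι)) {A A' : Finset ι} (B : Finset ι) (h : A' ⊆ A) :
    chainHeight F A B ≤ chainHeight F A' B :=
  ((hasChain_chainHeight F A B).anti h).le_chainHeight

theorem chainHeight_mono (F : Finset (Finset ι)) (A : Finset ι) {B B' : Finset ι}
    (h : ∀ c ∈ F, c ⊆ B → c ⊆ B') : chainHeight F A B ≤ chainHeight F A B' :=
  ((hasChain_chainHeight F A B).mono h).le_chainHeight

theorem one_le_chainHeight {F : Finset (Finset ι)} {A B c : Finset ι} (hc : c ∈ F) (hcB : c ⊆ B)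
    (hcA : ¬ c ⊆ A) : 1 ≤ chainHeight F A B :=
  HasChain.le_chainHeight (ℓ := 1) ⟨c, hc, hcB, hcA, trivial⟩

/-! ### Counting all words -/

/-- The words of `F` contained in `B`, with the elements of `A` deleted. -/
def words (F : Finset (Finset ι)) (A B : Finset ι) : Finset (Finset ι) :=
  (F.filter (· ⊆ B)).image (· \ A)

theorem mem_words {F : Finset (Finset ι)} {A B r : Finset ι} :
    r ∈ words F A B ↔ ∃ c ∈ F, c ⊆ B ∧ c \ A = r := by
  simp [words, and_assoc]

/-- The elements outside `A` that are covered by the words of `F` contained in `B`. -/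
def cover (F : Finset (Finset ι)) (A B : Finset ι) : Finset ι :=
  (words F A B).biUnion id

theorem subset_cover {F : Finset (Finset ι)} {A B r : Finset ι} (hr : r ∈ words F A B) :
    r ⊆ cover F A B := subset_biUnion_of_mem id hr

theorem exists_mem_of_mem_cover {F : Finset (Finset ι)} {A B : Finset ι} {i : ι}
    (hi : i ∈ cover F A B) : i ∉ A ∧ ∃ c ∈ F, c ⊆ B ∧ i ∈ c := by
  simp only [cover, mem_biUnion, mem_words, id] at hi
  obtain ⟨_, ⟨c, hc, hcB, rfl⟩, hi⟩ := hi
  rw [mem_sdiff] at hi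
  exact ⟨hi.2, c, hc, hcB, hi.1⟩

theorem cover_subset (F : Finset (Finset ι)) (A B : Finset ι) : cover F A B ⊆ B \ A := by
  intro i hi
  obtain ⟨hA, c, -, hcB, hic⟩ := exists_mem_of_mem_cover hi
  exact mem_sdiff.2 ⟨hcB hic, hA⟩

theorem mem_words_erase {F : Finset (Finset ι)} {A B r : Finset ι} {i : ι}
    (hr : r ∈ words F A B) (hi : i ∉ r) (hiA : i ∉ A) : r ∈ words F A (B.erase i) := by
  obtain ⟨c, hc, hcB, rfl⟩ := mem_words.1 hr
  refine mem_words.2 ⟨c, hc, fun x hx => mem_erase.2 ⟨?_, hcB hx⟩, rfl⟩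
  rintro rfl
  exact hi (mem_sdiff.2 ⟨hx, hiA⟩)

/-- A word through `i` extends any chain that avoids `i`. Deleting a covered element is thus the
step on which both counting inductions run. -/
theorem chainHeight_erase_lt {F : Finset (Finset ι)} {A B : Finset ι} (hAB : A ⊆ B) {i : ι}
    (hi : i ∈ cover F A B) : chainHeight F A (B.erase i) < chainHeight F A B := by
  obtain ⟨hA, c, hc, hcB, hic⟩ := exists_mem_of_mem_cover hi
  have h1 : A ⊆ B.erase i := fun x hx => mem_erase.2 ⟨by rintro rfl; exact hA hx, hAB hx⟩
  have h2 := chainHeight_add_le F h1 (erase_subset i B)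
  have h3 : 1 ≤ chainHeight F (B.erase i) B :=
    one_le_chainHeight hc hcB fun h => (mem_erase.1 (h hic)).1 rfl
  omega

/-- A word is either the whole cover or misses some covered `i`; in the latter case it survives in
`B.erase i`, which has smaller height. -/
theorem card_words_le {F : Finset (Finset ι)} {A : Finset ι} {n k : ℕ} {B : Finset ι}
    (hAB : A ⊆ B) (hn : #(B \ A) ≤ n) (hk : chainHeight F A B ≤ k) :
    #(words F A B) ≤ (n + 1) ^ k := by
  induction k generalizing B with
  | zero =>
    rw [pow_zero, card_le_one]
    have h0 : ∀ r ∈ words F A B, r = ∅ := by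
      intro r hr
      by_contra hne
      obtain ⟨i, hi⟩ := nonempty_iff_ne_empty.2 hne
      have := chainHeight_erase_lt hAB (subset_cover hr hi)
      omega
    intro r hr s hs
    rw [h0 r hr, h0 s hs]
  | succ k ih =>
    have hsub : words F A B ⊆
        insert (cover F A B) ((cover F A B).biUnion fun i => words F A (B.erase i)) := by
      intro r hr
      by_cases hrc : cover F A B ⊆ r
      · exact mem_insert.2 (Or.inl ((subset_cover hr).antisymm hrc))
      · obtain ⟨i, hi, hir⟩ := not_subset.1 hrc
        exact mem_insert_of_mem (mem_biUnion.2 ⟨i, hi,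
          mem_words_erase hr hir (exists_mem_of_mem_cover hi).1⟩)
    have h1 : #((cover F A B).biUnion fun i => words F A (B.erase i)) ≤
        #(cover F A B) * (n + 1) ^ k := by
      refine card_biUnion_le_card_mul _ _ _ fun i hi => ih ?_ ?_ ?_
      · exact fun x hx => mem_erase.2
          ⟨by rintro rfl; exact (exists_mem_of_mem_cover hi).1 hx, hAB hx⟩
      · exact (card_le_card (sdiff_subset_sdiff (erase_subset i B) le_rfl)).trans hn
      · have := chainHeight_erase_lt hAB hi
        omega
    have h2 : #(cover F A B) ≤ n := (card_le_card (cover_subset F A B)).trans hn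
    have h3 : 1 ≤ (n + 1) ^ k := Nat.one_le_pow _ _ (Nat.succ_pos n)
    calc #(words F A B) ≤ _ := card_le_card hsub
      _ ≤ _ := card_insert_le _ _
      _ ≤ n * (n + 1) ^ k + (n + 1) ^ k := by gcongr; exact h1.trans (by gcongr)
      _ = (n + 1) ^ (k + 1) := by ring

/-! ### Counting light words over a dense set -/

/-- Outside `A`, every set has weight at least `d` times its chain height. -/
def IsDense (F : Finset (Finset ι)) (w : ι → ℝ) (A : Finset ι) (d : ℝ) : Prop :=
  ∀ T, A ⊆ T → d * chainHeight F A T ≤ ∑ i ∈ T \ A, w i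

theorem IsDense.le_sum_cover {F : Finset (Finset ι)} {w : ι → ℝ} {A : Finset ι} {d : ℝ}
    (hd : 0 ≤ d) (h : IsDense F w A d) (B : Finset ι) :
    d * chainHeight F A B ≤ ∑ i ∈ cover F A B, w i := by
  have h1 : chainHeight F A B ≤ chainHeight F A (A ∪ cover F A B) := by
    refine chainHeight_mono F A fun c hc hcB => ?_
    have := subset_cover (mem_words.2 ⟨c, hc, hcB, rfl⟩ : c \ A ∈ words F A B)
    intro x hx
    by_cases hxA : x ∈ A
    · exact mem_union_left _ hxA
    · exact mem_union_right _ (this (mem_sdiff.2 ⟨hx, hxA⟩))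
  have h2 := h (A ∪ cover F A B) subset_union_left
  have h3 : (A ∪ cover F A B) \ A = cover F A B := by
    rw [union_sdiff_cancel_left]
    exact disjoint_left.2 fun x hx hx' => (exists_mem_of_mem_cover hx').1 hx
  rw [h3] at h2
  refine le_trans ?_ h2
  gcongr

/-- Contraction: delete a covered element drawn with probability proportional to its weight. The
height drops, while a light word survives with good probability because density makes the cover
heavy. The draw is carried out as a weighted double count. -/
theorem card_light_words_le {F : Finset (Finset ι)} {w : ι → ℝ} {A : Finset ι} {d : ℝ}
    (hw : ∀ i, 0 ≤ w i) (hd : 0 < d) (h : IsDense F w A d) {n : ℕ} (a k : ℕ) {B : Finset ι}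
    (hAB : A ⊆ B) (hn : #(B \ A) ≤ n) (hk : chainHeight F A B ≤ k) :
    (#((words F A B).filter fun r => ∑ i ∈ r, w i ≤ a * d) : ℝ) ≤
      ((n : ℝ) + 1) ^ (2 * a) * ((k : ℝ) + 1) ^ (2 * a) := by
  induction k generalizing B with
  | zero =>
    have h1 := (card_filter_le (words F A B) fun r => ∑ i ∈ r, w i ≤ a * d).trans
      (card_words_le hAB hn hk)
    have h2 : (#((words F A B).filter fun r => ∑ i ∈ r, w i ≤ a * d) : ℝ) ≤ 1 := by
      exact_mod_cast h1
    refine h2.trans ?_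
    simp only [Nat.cast_zero, zero_add, one_pow, mul_one]
    exact one_le_pow₀ (by linarith [Nat.cast_nonneg (α := ℝ) n])
  | succ k ih =>
    rcases Nat.lt_or_ge (chainHeight F A B) (k + 1) with hlt | hge
    · refine (ih hAB hn (Nat.lt_succ_iff.1 hlt)).trans ?_
      gcongr
      linarith
    have heq : chainHeight F A B = k + 1 := le_antisymm hk hge
    rcases Nat.lt_or_ge (2 * a) (k + 1) with hak | hak
    swap
    · have h1 := (card_filter_le (words F A B) fun r => ∑ i ∈ r, w i ≤ a * d).trans
        (card_words_le hAB hn hk)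
      have h2 : (#((words F A B).filter fun r => ∑ i ∈ r, w i ≤ a * d) : ℝ) ≤
          ((n : ℝ) + 1) ^ (k + 1) := by exact_mod_cast h1
      have h3 : (1 : ℝ) ≤ n + 1 := by linarith [Nat.cast_nonneg (α := ℝ) n]
      have h4 : (1 : ℝ) ≤ (((k + 1 : ℕ) : ℝ) + 1) ^ (2 * a) :=
        one_le_pow₀ (by linarith [Nat.cast_nonneg (α := ℝ) (k + 1)])
      calc _ ≤ _ := h2
        _ ≤ ((n : ℝ) + 1) ^ (2 * a) := pow_le_pow_right₀ h3 hak
        _ ≤ _ := le_mul_of_one_le_right (by positivity) h4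
    set N := (words F A B).filter fun r => ∑ i ∈ r, w i ≤ a * d with hN
    set W := ∑ i ∈ cover F A B, w i with hW
    set M : ℝ := ((n : ℝ) + 1) ^ (2 * a) * ((k : ℝ) + 1) ^ (2 * a) with hM
    have hM0 : 0 ≤ M := by positivity
    have hdW : d * (k + 1) ≤ W := by
      have := h.le_sum_cover hd.le B
      rw [heq] at this
      exact_mod_cast this
    have hstep : ∀ i ∈ cover F A B, (#(N.filter fun r => i ∉ r) : ℝ) ≤ M := by
      intro i hi
      have hiA := (exists_mem_of_mem_cover hi).1
      refine le_trans ?_ (ih (B := B.erase i) ?_ ?_ ?_)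
      · refine Nat.cast_le.2 (card_le_card fun r hr => ?_)
        simp only [hN, mem_filter] at hr ⊢
        exact ⟨mem_words_erase hr.1.1 hr.2 hiA, hr.1.2⟩
      · exact fun x hx => mem_erase.2 ⟨by rintro rfl; exact hiA hx, hAB hx⟩
      · exact (card_le_card (sdiff_subset_sdiff (erase_subset i B) le_rfl)).trans hn
      · have := chainHeight_erase_lt hAB hi
        omega
    have hdouble : ∑ i ∈ cover F A B, w i * (#(N.filter fun r => i ∉ r) : ℝ) =
        ∑ r ∈ N, (W - ∑ i ∈ r, w i) := by
      have h1 : ∀ r ∈ N, W - ∑ i ∈ r, w i = ∑ i ∈ cover F A B, if i ∉ r then w i else 0 := by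
        intro r hr
        have hsub : r ⊆ cover F A B := subset_cover (mem_filter.1 hr).1
        rw [← sum_filter, hW, ← sum_sdiff hsub, add_sub_cancel_right]
        refine sum_congr ?_ fun _ _ => rfl
        ext x
        simp
      rw [sum_congr rfl h1, sum_comm]
      refine sum_congr rfl fun i _ => ?_
      rw [← sum_filter, sum_const, nsmul_eq_mul, mul_comm]
    have hup : ∑ i ∈ cover F A B, w i * (#(N.filter fun r => i ∉ r) : ℝ) ≤ W * M := by
      rw [hW, sum_mul]
      exact sum_le_sum fun i hi => mul_le_mul_of_nonneg_left (hstep i hi) (hw i)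
    have hlow : (#N : ℝ) * (W - a * d) ≤ ∑ r ∈ N, (W - ∑ i ∈ r, w i) := by
      rw [← nsmul_eq_mul, ← sum_const]
      exact sum_le_sum fun r hr => by linarith [(mem_filter.1 hr).2]
    have hmain : (#N : ℝ) * (W - a * d) ≤ W * M := by linarith
    have hk0 : (0 : ℝ) < k + 1 := by positivity
    have hak' : 2 * (a : ℝ) ≤ k + 1 := by exact_mod_cast hak.le
    have ha0 : (0 : ℝ) ≤ a := Nat.cast_nonneg a
    have hWpos : 0 < W := lt_of_lt_of_le (by positivity) hdW
    -- the survival probability is at least `1 - a / (k + 1)`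
    have hx : (1 - a / (k + 1 : ℝ)) * W ≤ W - a * d := by
      have : a * d ≤ a / (k + 1 : ℝ) * W := by
        rw [div_mul_eq_mul_div, le_div_iff₀ hk0]
        nlinarith [mul_le_mul_of_nonneg_left hdW ha0]
      linarith
    have hNM : (#N : ℝ) * (1 - a / (k + 1 : ℝ)) ≤ M := by
      have := (mul_le_mul_of_nonneg_left hx (Nat.cast_nonneg (α := ℝ) #N)).trans hmain
      refine le_of_mul_le_mul_right ?_ hWpos
      linarith
    set x : ℝ := a / (k + 1 : ℝ) with hxdef
    have hx0 : 0 ≤ x := by positivity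
    have hx2 : x ≤ 1 / 2 := by
      rw [hxdef, div_le_iff₀ hk0]
      linarith
    -- The loss `1 / (1 - x) ≤ 1 + 2 * x` is absorbed by the growth from `(k + 1) ^ (2 * a)` to `(k
    -- + 2) ^ (2 * a)`.
    have hbern : 1 + 2 * x ≤ (1 + 1 / (k + 1 : ℝ)) ^ (2 * a) := by
      have := one_add_mul_le_pow (a := 1 / (k + 1 : ℝ)) (by
        have : (0 : ℝ) ≤ 1 / (k + 1 : ℝ) := by positivity
        linarith) (2 * a)
      refine le_trans (le_of_eq ?_) this
      push_cast
      rw [hxdef]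
      ring
    have hN0 : (#N : ℝ) ≤ M * (1 + 2 * x) := by
      have h1 : (1 : ℝ) ≤ (1 - x) * (1 + 2 * x) := by nlinarith
      calc (#N : ℝ) ≤ #N * ((1 - x) * (1 + 2 * x)) := le_mul_of_one_le_right (by positivity) h1
        _ = #N * (1 - x) * (1 + 2 * x) := by ring
        _ ≤ M * (1 + 2 * x) := by gcongr
    calc (#N : ℝ) ≤ M * (1 + 2 * x) := hN0
      _ ≤ M * (1 + 1 / (k + 1 : ℝ)) ^ (2 * a) := by gcongr
      _ = _ := by
        rw [hM, mul_assoc, ← mul_pow]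
        congr 2
        push_cast
        field_simp

theorem sum_range_pow_succ_le {x : ℝ} (h0 : 0 ≤ x) (h1 : x ≤ 1 / 2) (M : ℕ) :
    ∑ a ∈ range M, x ^ (a + 1) ≤ 2 * x := by
  have : ∑ a ∈ range M, x ^ (a + 1) + 2 * x ^ (M + 1) ≤ 2 * x := by
    induction M with
    | zero => simp
    | succ M ih =>
      rw [sum_range_succ]
      have : x ^ (M + 1 + 1) ≤ x ^ (M + 1) * (1 / 2) := by
        rw [pow_succ]
        gcongr
      linarith
  linarith [pow_nonneg h0 (M + 1)]

theorem IsDense.le_sum_word [Fintype ι] {F : Finset (Finset ι)} {w : ι → ℝ} {A : Finset ι}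
    {d : ℝ} (hd : 0 ≤ d) (h : IsDense F w A d) {c : Finset ι} (hc : c ∈ F) (hcA : ¬ c ⊆ A) :
    d ≤ ∑ i ∈ c \ A, w i := by
  have h1 := h (A ∪ c) subset_union_left
  rw [union_sdiff_left] at h1
  have h2 : (1 : ℝ) ≤ chainHeight F A (A ∪ c) := by
    exact_mod_cast one_le_chainHeight hc subset_union_right hcA
  nlinarith

/-- The union bound for one scale. The cap at `k` is harmless because there are at most `(n + 1) ^
k` words in all. -/
theorem sum_exp_neg_word_le [Fintype ι] {F : Finset (Finset ι)} {w : ι → ℝ} {A : Finset ι}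
    {d : ℝ} (hw : ∀ i, 0 ≤ w i) (hd : 0 < d) (h : IsDense F w A d) {n k : ℕ}
    (hn : #(univ \ A) ≤ n) (hk : chainHeight F A univ ≤ k) (hk1 : 1 ≤ k) :
    ∑ r ∈ (words F A univ).filter (·.Nonempty),
      Real.exp (-(20 * Real.log (n + 2) * min ((∑ i ∈ r, w i) / d) k)) ≤
        3 * (((n : ℝ) + 2) ^ 6)⁻¹ := by
  set R := (words F A univ).filter (·.Nonempty) with hR
  set Q : ℝ := n + 2 with hQ
  have hQ2 : 2 ≤ Q := by linarith [Nat.cast_nonneg (α := ℝ) n]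
  have hQ1 : 1 ≤ Q := by linarith
  have hQ0 : 0 < Q := by linarith
  have hlog : 0 ≤ Real.log Q := Real.log_nonneg hQ1
  have hexp : ∀ s a : ℕ, Real.exp (-(s * Real.log Q * a)) = ((Q ^ s)⁻¹) ^ a := by
    intro s a
    rw [Real.exp_neg, mul_comm, ← mul_assoc, ← Nat.cast_mul, Real.exp_nat_mul,
      Real.exp_log hQ0, inv_pow, ← pow_mul, mul_comm]
  have hword : ∀ r ∈ R, 1 ≤ (∑ i ∈ r, w i) / d := by
    intro r hr
    obtain ⟨hr, i, hi⟩ := mem_filter.1 hr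
    obtain ⟨c, hc, -, rfl⟩ := mem_words.1 hr
    rw [le_div_iff₀ hd, one_mul]
    exact h.le_sum_word hd.le hc fun hcA => (mem_sdiff.1 hi).2 (hcA (mem_sdiff.1 hi).1)
  set ht : Finset ι → ℕ := fun r => ⌈(∑ i ∈ r, w i) / d⌉₊ with hht
  have hsplit : ∀ r ∈ R, Real.exp (-(20 * Real.log Q * min ((∑ i ∈ r, w i) / d) k)) ≤
      ((Q ^ 10)⁻¹) ^ ht r + ((Q ^ 20)⁻¹) ^ k := by
    intro r hr
    have h1 := hword r hr
    -- Density gives a ratio of at least 1, so rounding up at most doubles it and the exponent 20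
    -- becomes 10.
    have hceil : (ht r : ℝ) ≤ 2 * ((∑ i ∈ r, w i) / d) := by
      have := Nat.ceil_lt_add_one (le_trans zero_le_one h1)
      simp only [hht]
      linarith
    rcases min_choice ((∑ i ∈ r, w i) / d) (k : ℝ) with hm | hm
    · rw [hm]
      refine le_add_of_le_of_nonneg ?_ (by positivity)
      rw [← hexp, Real.exp_le_exp, neg_le_neg_iff]
      push_cast
      nlinarith
    · rw [hm]
      refine le_add_of_nonneg_of_le (by positivity) ?_
      rw [← hexp]
      norm_num
  set x : ℝ := (Q ^ 6)⁻¹ with hx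
  have hx0 : 0 ≤ x := by positivity
  have hx2 : x ≤ 1 / 2 := by
    rw [hx, inv_eq_one_div]
    refine one_div_le_one_div_of_le (by norm_num) (hQ2.trans ?_)
    exact le_self_pow₀ hQ1 (by norm_num)
  have hfar : ∑ _r ∈ R, ((Q ^ 20)⁻¹) ^ k ≤ x := by
    have hcard : (#R : ℝ) ≤ Q ^ k := by
      have := (card_filter_le (words F A univ) (·.Nonempty)).trans
        (card_words_le (subset_univ A) hn hk)
      calc (#R : ℝ) ≤ ((n + 1 : ℕ) : ℝ) ^ k := by exact_mod_cast this
        _ ≤ Q ^ k := by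
          gcongr
          push_cast
          linarith
    rw [sum_const, nsmul_eq_mul]
    have hb : Q * (Q ^ 20)⁻¹ ≤ x := by
      rw [hx, ← div_eq_mul_inv, div_le_iff₀ (by positivity), inv_mul_eq_div,
        le_div_iff₀ (by positivity), ← pow_succ']
      exact pow_le_pow_right₀ hQ1 (by norm_num)
    calc (#R : ℝ) * ((Q ^ 20)⁻¹) ^ k ≤ Q ^ k * ((Q ^ 20)⁻¹) ^ k := by gcongr
      _ = (Q * (Q ^ 20)⁻¹) ^ k := (mul_pow _ _ _).symm
      _ ≤ x ^ k := by gcongr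
      _ ≤ x := pow_le_of_le_one hx0 (by linarith) (by omega)
  have hnear : ∑ r ∈ R, ((Q ^ 10)⁻¹) ^ ht r ≤ 2 * x := by
    obtain ⟨M, hM⟩ : ∃ M, ∀ r ∈ R, ht r < M :=
      ⟨R.sup ht + 1, fun r hr => Nat.lt_succ_of_le (le_sup hr)⟩
    have hmaps : ∀ r ∈ R, ht r - 1 ∈ range M := fun r hr =>
      mem_range.2 (lt_of_le_of_lt (Nat.sub_le _ _) (hM r hr))
    have hpos : ∀ r ∈ R, 1 ≤ ht r := fun r hr =>
      Nat.one_le_ceil_iff.2 (by linarith [hword r hr])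
    rw [← sum_fiberwise_of_maps_to hmaps]
    refine le_trans (sum_le_sum fun a _ => ?_) (sum_range_pow_succ_le hx0 hx2 M)
    -- At height `h = a + 1` there are at most `Q ^ (4 * h)` words, each contributing `Q ^ (-10 *
    -- h)`; the sum over `h` is geometric with ratio `x = Q ^ (-6)`.
    have hfib : (#(R.filter fun r => ht r - 1 = a) : ℝ) ≤ (Q ^ 4) ^ (a + 1) := by
      have h1 : R.filter (fun r => ht r - 1 = a) ⊆
          (words F A univ).filter fun r => ∑ i ∈ r, w i ≤ ((a + 1 : ℕ) : ℝ) * d := by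
        intro r hr
        obtain ⟨hr, hra⟩ := mem_filter.1 hr
        refine mem_filter.2 ⟨(mem_filter.1 hr).1, ?_⟩
        have h2 : ht r = a + 1 := by have := hpos r hr; omega
        rw [← h2, ← div_le_iff₀ hd]
        exact Nat.le_ceil _
      have h2 : chainHeight F A univ ≤ n := (chainHeight_le_card F A univ).trans hn
      refine (Nat.cast_le.2 (card_le_card h1)).trans
        ((card_light_words_le hw hd h (a + 1) n (subset_univ A) hn h2).trans ?_)
      rw [← mul_pow, pow_mul]
      refine pow_le_pow_left₀ (by positivity) ?_ _
      have h3 : ((n : ℝ) + 1) ≤ Q := by linarith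
      calc (((n : ℝ) + 1) * (n + 1)) ^ 2 ≤ (Q * Q) ^ 2 := by gcongr
        _ = Q ^ 4 := by ring
    have hcon : ∀ r ∈ R.filter (fun r => ht r - 1 = a),
        ((Q ^ 10)⁻¹) ^ ht r = ((Q ^ 10)⁻¹) ^ (a + 1) := by
      intro r hr
      obtain ⟨hr, hra⟩ := mem_filter.1 hr
      have h2 : ht r = a + 1 := by have := hpos r hr; omega
      rw [h2]
    rw [sum_congr rfl hcon, sum_const, nsmul_eq_mul]
    calc _ ≤ (Q ^ 4) ^ (a + 1) * ((Q ^ 10)⁻¹) ^ (a + 1) := by gcongr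
      _ = x ^ (a + 1) := by
        rw [← mul_pow, hx]
        congr 1
        field_simp
  calc _ ≤ ∑ r ∈ R, (((Q ^ 10)⁻¹) ^ ht r + ((Q ^ 20)⁻¹) ^ k) := sum_le_sum hsplit
    _ ≤ 3 * x := by
      rw [sum_add_distrib]
      linarith

/-! ### Decomposition into scales -/

/-- Take `A'` maximizing `d * chainHeight F Z T - w(T)` over `T ⊇ A`. Comparison with larger `T`,
together with superadditivity, gives density; comparison with `A` itself gives the weight bound. -/
theorem exists_isDense_superset [Fintype ι] (F : Finset (Finset ι)) (w : ι → ℝ) {d : ℝ}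
    (hd : 0 ≤ d) {Z A : Finset ι} (hZ : Z ⊆ A) :
    ∃ A', A ⊆ A' ∧ IsDense F w A' d ∧
      ∑ i ∈ A' \ A, w i ≤ d * (chainHeight F Z A' - chainHeight F Z A) := by
  obtain ⟨A', hA', hmax⟩ := exists_max_image ((univ : Finset (Finset ι)).filter (A ⊆ ·))
    (fun T => d * chainHeight F Z T - ∑ i ∈ T, w i) ⟨A, by simp⟩
  have hA : A ⊆ A' := (mem_filter.1 hA').2
  refine ⟨A', hA, fun T hT => ?_, ?_⟩
  · have h1 := hmax T (mem_filter.2 ⟨mem_univ _, hA.trans hT⟩)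
    have h2 : (chainHeight F Z A' : ℝ) + chainHeight F A' T ≤ chainHeight F Z T := by
      exact_mod_cast chainHeight_add_le F (hZ.trans hA) hT
    have h3 := sum_sdiff (f := w) hT
    nlinarith
  · have h1 := hmax A (mem_filter.2 ⟨mem_univ _, Subset.rfl⟩)
    have h3 := sum_sdiff (f := w) hA
    linarith

theorem exists_scales [Fintype ι] (F : Finset (Finset ι)) {w : ι → ℝ} (hw : ∀ i, 0 ≤ w i) :
    ∃ (d : ℝ) (A : ℕ → Finset ι) (J : ℕ), 0 < d ∧ Monotone A ∧ A 0 = univ.filter (w · = 0) ∧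
      (∀ j, IsDense F w (A j) (d * 2 ^ j)) ∧
      (∀ j, ∑ i ∈ A (j + 1) \ A j, w i ≤
        d * 2 ^ (j + 1) * (chainHeight F (A 0) (A (j + 1)) - chainHeight F (A 0) (A j))) ∧
      ∀ c ∈ F, c ⊆ A J := by
  -- With `d` at most every nonzero weight, the zero set of `w` is already dense at scale `d`, since
  -- height is at most cardinality.
  obtain ⟨d, hd, hdw⟩ : ∃ d : ℝ, 0 < d ∧ ∀ i, w i ≠ 0 → d ≤ w i := by
    have hne : (insert (1 : ℝ) ((univ.filter (w · ≠ 0)).image w)).Nonempty := insert_nonempty _ _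
    refine ⟨(insert (1 : ℝ) ((univ.filter (w · ≠ 0)).image w)).min' hne, ?_, fun i hi => ?_⟩
    · rw [lt_min'_iff]
      intro y hy
      rcases mem_insert.1 hy with rfl | hy
      · exact one_pos
      · obtain ⟨i, hi, rfl⟩ := mem_image.1 hy
        exact lt_of_le_of_ne (hw i) (Ne.symm (mem_filter.1 hi).2)
    · refine min'_le _ _ (mem_insert_of_mem (mem_image_of_mem w ?_))
      simpa using hi
  set Z := univ.filter (w · = 0) with hZ
  have hstep : ∀ (j : ℕ) (A : Finset ι), ∃ A', Z ⊆ A → A ⊆ A' ∧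
      IsDense F w A' (d * 2 ^ (j + 1)) ∧
      ∑ i ∈ A' \ A, w i ≤ d * 2 ^ (j + 1) * (chainHeight F Z A' - chainHeight F Z A) := by
    intro j A
    by_cases h : Z ⊆ A
    · obtain ⟨A', hA'⟩ := exists_isDense_superset F w (d := d * 2 ^ (j + 1)) (by positivity) h
      exact ⟨A', fun _ => hA'⟩
    · exact ⟨A, fun h' => absurd h' h⟩
  choose next hnext using hstep
  let A : ℕ → Finset ι := fun j => Nat.rec Z next j
  have hA0 : A 0 = Z := rfl
  have hAs : ∀ j, A (j + 1) = next j (A j) := fun _ => rfl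
  have hZA : ∀ j, Z ⊆ A j := by
    intro j
    induction j with
    | zero => exact Subset.rfl
    | succ j ih => exact ih.trans (hnext j (A j) ih).1
  have hdense : ∀ j, IsDense F w (A j) (d * 2 ^ j) := by
    intro j
    cases j with
    | zero =>
      intro T _
      rw [pow_zero, mul_one, hA0]
      have h1 : (chainHeight F Z T : ℝ) ≤ #(T \ Z) := by
        exact_mod_cast chainHeight_le_card F Z T
      calc d * chainHeight F Z T ≤ d * #(T \ Z) := by gcongr
        _ = ∑ _i ∈ T \ Z, d := by rw [sum_const, nsmul_eq_mul, mul_comm]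
        _ ≤ _ := sum_le_sum fun i hi => hdw i (by simpa [hZ] using (mem_sdiff.1 hi).2)
    | succ j => exact (hnext j (A j) (hZA j)).2.1
  -- Once `d * 2 ^ J` exceeds the total weight, density forbids any word to leave `A J`.
  obtain ⟨J, hJ⟩ := pow_unbounded_of_one_lt ((∑ i, w i) / d) (one_lt_two (α := ℝ))
  refine ⟨d, A, J, hd, monotone_nat_of_le_succ fun j => (hnext j (A j) (hZA j)).1, hA0, hdense,
    fun j => (hnext j (A j) (hZA j)).2.2, fun c hc => ?_⟩
  by_contra hcA
  have h1 := (hdense J).le_sum_word (by positivity) hc hcA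
  have h2 : ∑ i ∈ c \ A J, w i ≤ ∑ i, w i :=
    sum_le_univ_sum_of_nonneg hw
  rw [div_lt_iff₀ hd] at hJ
  linarith

theorem sum_inter_telescope {A : ℕ → Finset ι} (hA : Monotone A) (c : Finset ι) (f : ι → ℝ)
    (J : ℕ) : ∑ i ∈ c ∩ A J, f i =
      ∑ i ∈ c ∩ A 0, f i + ∑ j ∈ range J, ∑ i ∈ c ∩ (A (j + 1) \ A j), f i := by
  induction J with
  | zero => simp
  | succ J ih =>
    rw [sum_range_succ, ← add_assoc, ← ih, ← sum_union]
    · refine sum_congr ?_ fun _ _ => rfl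
      rw [← inter_union_distrib_left, union_sdiff_of_subset (hA (Nat.le_succ J))]
    · exact disjoint_left.2 fun i hi hi' =>
        (mem_sdiff.1 (mem_inter.1 hi').2).2 (mem_inter.1 hi).2

/-- Only the top `L` scales pay the full `y`; below them the terms `κ * (d * 2 ^ j)` decay
geometrically and total at most `2 * y`. -/
theorem sum_min_geometric_le {d y κ : ℝ} (hd : 0 < d) (L : ℕ) (hκ : κ ≤ 2 ^ L) (M : ℕ)
    (hM : d * 2 ^ M ≤ y) : ∑ j ∈ range (M + 1), min y (κ * (d * 2 ^ j)) ≤ (L + 2) * y := by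
  have hy : 0 ≤ y := le_trans (by positivity) hM
  rcases Nat.lt_or_ge M L with hML | hLM
  · calc ∑ j ∈ range (M + 1), min y (κ * (d * 2 ^ j)) ≤ ∑ _j ∈ range (M + 1), y :=
        sum_le_sum fun j _ => min_le_left _ _
      _ = ((M + 1 : ℕ) : ℝ) * y := by simp
      _ ≤ (L + 2) * y := by
        gcongr
        exact_mod_cast (by omega : M + 1 ≤ L + 2)
  · obtain ⟨N, rfl⟩ := Nat.exists_eq_add_of_le' hLM
    have h1 : ∀ t : ℕ, ∑ j ∈ range (t + 1), κ * (d * 2 ^ j) ≤ 2 * (2 ^ L * (d * 2 ^ t)) := by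
      intro t
      induction t with
      | zero =>
        have : 0 ≤ 2 ^ L * d := by positivity
        have : κ * d ≤ 2 ^ L * d := by gcongr
        simp
        linarith
      | succ t ih =>
        rw [sum_range_succ]
        have : κ * (d * 2 ^ (t + 1)) ≤ 2 ^ L * (d * 2 ^ (t + 1)) := by gcongr
        calc _ ≤ 2 * (2 ^ L * (d * 2 ^ t)) + 2 ^ L * (d * 2 ^ (t + 1)) := add_le_add ih this
          _ = _ := by ring
    rw [show N + L + 1 = (N + 1) + L by ring, sum_range_add]
    have h2 : ∑ j ∈ range (N + 1), min y (κ * (d * 2 ^ j)) ≤ 2 * y := by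
      refine (sum_le_sum fun j _ => min_le_right _ _).trans ((h1 N).trans ?_)
      calc 2 * (2 ^ L * (d * 2 ^ N)) = 2 * (d * 2 ^ (N + L)) := by ring
        _ ≤ 2 * y := by gcongr
    have h3 : ∑ j ∈ range L, min y (κ * (d * 2 ^ (N + 1 + j))) ≤ L * y := by
      refine (sum_le_sum fun j _ => min_le_left _ _).trans ?_
      simp
    linarith

/-! ### Independent sampling and Chernoff bounds -/

/-- Independent sampling: if the sum of the exponential moments is less than one, then some set
satisfies all the upper bounds simultaneously. -/
theorem exists_sample [Fintype ι] {τ : Type*} (T : Finset τ) (p : ι → ℝ)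
    (hp0 : ∀ i, 0 ≤ p i) (hp1 : ∀ i, p i ≤ 1) (u₁ u₀ v : τ → ι → ℝ) (β : τ → ℝ)
    (huv : ∀ t ∈ T, ∀ i,
      p i * Real.exp (u₁ t i) + (1 - p i) * Real.exp (u₀ t i) ≤ Real.exp (v t i))
    (hsum : ∑ t ∈ T, Real.exp (∑ i, v t i - β t) < 1) :
    ∃ S : Finset ι, ∀ t ∈ T, ∑ i, (if i ∈ S then u₁ t i else u₀ t i) ≤ β t := by
  -- The product measure on subsets; `prod_add` computes its total mass and its exponential moments.
  let P : Finset ι → ℝ := fun S => (∏ i ∈ S, p i) * ∏ i ∈ univ \ S, (1 - p i)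
  have hP : ∀ S, 0 ≤ P S := fun S =>
    mul_nonneg (prod_nonneg fun i _ => hp0 i) (prod_nonneg fun i _ => sub_nonneg.2 (hp1 i))
  have hP1 : ∑ S ∈ (univ : Finset ι).powerset, P S = 1 := by
    rw [← prod_add]
    simp
  have hE : ∀ t, ∑ S ∈ (univ : Finset ι).powerset,
      P S * Real.exp (∑ i, (if i ∈ S then u₁ t i else u₀ t i)) =
      ∏ i, (p i * Real.exp (u₁ t i) + (1 - p i) * Real.exp (u₀ t i)) := by
    intro t
    rw [prod_add]
    refine sum_congr rfl fun S _ => ?_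
    rw [Real.exp_sum, ← prod_sdiff (subset_univ S), prod_mul_distrib, prod_mul_distrib]
    have h1 : ∏ i ∈ S, Real.exp (if i ∈ S then u₁ t i else u₀ t i) =
        ∏ i ∈ S, Real.exp (u₁ t i) := prod_congr rfl fun i hi => by rw [if_pos hi]
    have h2 : ∏ i ∈ univ \ S, Real.exp (if i ∈ S then u₁ t i else u₀ t i) =
        ∏ i ∈ univ \ S, Real.exp (u₀ t i) :=
      prod_congr rfl fun i hi => by rw [if_neg (mem_sdiff.1 hi).2]
    rw [h1, h2]
    simp only [P]
    ring
  by_contra! hcon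
  have hbad : ∀ S : Finset ι, 1 ≤ ∑ t ∈ T,
      Real.exp (∑ i, (if i ∈ S then u₁ t i else u₀ t i) - β t) := by
    intro S
    obtain ⟨t, ht, hlt⟩ := hcon S
    refine le_trans ?_ (single_le_sum (f := fun t =>
      Real.exp (∑ i, (if i ∈ S then u₁ t i else u₀ t i) - β t))
      (fun t _ => (Real.exp_pos _).le) ht)
    exact Real.one_le_exp (by linarith)
  have hle : ∑ S ∈ (univ : Finset ι).powerset, P S * ∑ t ∈ T,
      Real.exp (∑ i, (if i ∈ S then u₁ t i else u₀ t i) - β t) ≤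
      ∑ t ∈ T, Real.exp (∑ i, v t i - β t) := by
    simp_rw [mul_sum]
    rw [sum_comm]
    refine sum_le_sum fun t ht => ?_
    simp_rw [Real.exp_sub, mul_div_assoc']
    rw [← sum_div, hE]
    refine div_le_div_of_nonneg_right ?_ (Real.exp_pos _).le
    rw [Real.exp_sum]
    refine prod_le_prod (fun i _ => ?_) fun i _ => huv t ht i
    exact add_nonneg (mul_nonneg (hp0 i) (Real.exp_pos _).le)
      (mul_nonneg (sub_nonneg.2 (hp1 i)) (Real.exp_pos _).le)
  have hge : (1 : ℝ) ≤ ∑ S ∈ (univ : Finset ι).powerset, P S * ∑ t ∈ T,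
      Real.exp (∑ i, (if i ∈ S then u₁ t i else u₀ t i) - β t) := by
    rw [← hP1]
    exact sum_le_sum fun S _ => le_mul_of_one_le_right (hP S) (hbad S)
  linarith

/-- An element of weight at least `b` is kept surely and has no error. For a lighter one the
exponent is a centred Bernoulli variable scaled by `σ * ε`, and `exp u ≤ 1 + u + u ^ 2` applies. -/
theorem bernoulli_exp_moment_le {w b ε σ : ℝ} (hw : 0 ≤ w) (hb : 0 < b) (hε0 : 0 ≤ ε)
    (hε1 : ε ≤ 1) (hσ : σ = 1 ∨ σ = -1) :
    min 1 (w / b) * Real.exp (σ * (ε / b) * (w / min 1 (w / b) - w)) +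
      (1 - min 1 (w / b)) * Real.exp (σ * (ε / b) * (0 - w)) ≤ Real.exp (ε / b * ε * w) := by
  rcases le_total b w with h | h
  · rw [min_eq_left ((one_le_div hb).2 h)]
    simp only [div_one, sub_self, mul_zero, Real.exp_zero, zero_mul, add_zero, mul_one]
    exact Real.one_le_exp (by positivity)
  rcases hw.eq_or_lt with rfl | hw
  · simp
  rw [min_eq_right ((div_le_one hb).2 h)]
  set p := w / b with hp
  have hp0 : 0 < p := by positivity
  have hwp : w = p * b := by rw [hp]; field_simp
  have hu : |σ * ε| ≤ 1 := by
    rw [abs_mul, abs_of_nonneg hε0]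
    rcases hσ with rfl | rfl <;> simpa using hε1
  have hu2 : (σ * ε) ^ 2 = ε ^ 2 := by
    rcases hσ with rfl | rfl <;> ring
  have h1 : σ * (ε / b) * (w / p - w) = σ * ε + -(p * (σ * ε)) := by
    rw [hwp]
    field_simp
    ring
  have h2 : σ * (ε / b) * (0 - w) = -(p * (σ * ε)) := by
    rw [hwp]
    field_simp
    ring
  have h3 : ε / b * ε * w = p * ε ^ 2 := by
    rw [hwp]
    field_simp
  rw [h1, h2, h3, Real.exp_add]
  have h4 := (abs_le.1 (Real.abs_exp_sub_one_sub_id_le hu)).2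
  rw [hu2] at h4
  have h5 := Real.add_one_le_exp (p * (Real.exp (σ * ε) - 1))
  calc p * (Real.exp (σ * ε) * Real.exp (-(p * (σ * ε)))) +
        (1 - p) * Real.exp (-(p * (σ * ε)))
      = (p * (Real.exp (σ * ε) - 1) + 1) * Real.exp (-(p * (σ * ε))) := by ring
    _ ≤ Real.exp (p * (Real.exp (σ * ε) - 1)) * Real.exp (-(p * (σ * ε))) := by gcongr
    _ = Real.exp (p * (Real.exp (σ * ε) - 1 - σ * ε)) := by rw [← Real.exp_add]; ring_nf
    _ ≤ Real.exp (p * ε ^ 2) := by gcongr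

theorem exists_level {A : ℕ → Finset ι} (hA : Monotone A) :
    ∃ lev : ι → ℕ, ∀ j, ∀ i ∈ A (j + 1) \ A j, lev i = j := by
  have : ∀ i, ∃ l, ∀ j, i ∈ A (j + 1) \ A j → l = j := by
    intro i
    by_cases h : ∃ l, i ∈ A (l + 1) \ A l
    · obtain ⟨l, hl⟩ := h
      refine ⟨l, fun j hj => ?_⟩
      rw [mem_sdiff] at hl hj
      rcases lt_trichotomy l j with hlj | rfl | hlj
      · exact absurd (hA hlj hl.1) hj.2
      · rfl
      · exact absurd (hA hlj hj.1) hl.2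
    · exact ⟨0, fun j hj => absurd ⟨j, hj⟩ h⟩
  choose lev hlev using this
  exact ⟨lev, fun j i => hlev i j⟩

/-! ### One round of sparsification -/

/-- In block `j` a word may err by `ε` times its weight there plus `ε / L` times its total weight
capped at `k * d * 2 ^ j`. Each kind sums over the blocks to at most `ε` times the weight of the
word. -/
theorem exists_sparsifier_of_card_le [Fintype ι] (F : Finset (Finset ι)) {w : ι → ℝ}
    (hw : ∀ i, 0 ≤ w i) {k n : ℕ} (hk : chainHeight F ∅ univ ≤ k) (hk1 : 1 ≤ k)
    (hn : #(univ.filter (w · ≠ 0)) ≤ n) {ε : ℝ} (hε : 0 < ε) (hε1 : ε ≤ 1) :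
    ∃ w' : ι → ℝ, (∀ i, 0 ≤ w' i) ∧
      (∀ c ∈ F, |∑ i ∈ c, w' i - ∑ i ∈ c, w i| ≤ 2 * ε * ∑ i ∈ c, w i) ∧
      (#(univ.filter (w' · ≠ 0)) : ℝ) ≤
        4 * (20 * (Nat.clog 2 k + 2) * Real.log (n + 2) / ε ^ 2) * k + 1 := by
  obtain ⟨d, A, J, hd, hmono, hA0, hdense, hblock, hJ⟩ := exists_scales F hw
  obtain ⟨lev, hlev⟩ := exists_level hmono
  set L : ℝ := Nat.clog 2 k + 2 with hL
  have hL0 : 0 < L := by positivity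
  have hlog : 0 < Real.log (n + 2) :=
    Real.log_pos (by linarith [Nat.cast_nonneg (α := ℝ) n])
  set ρ : ℝ := 20 * L * Real.log (n + 2) / ε ^ 2 with hρ
  have hρ0 : 0 < ρ := by positivity
  have hD : ∀ j, 0 < d * 2 ^ j := fun j => by positivity
  set b : ℕ → ℝ := fun j => d * 2 ^ j / ρ with hb
  have hb0 : ∀ j, 0 < b j := fun j => div_pos (hD j) hρ0
  set p : ι → ℝ := fun i => if i ∈ A J then min 1 (w i / b (lev i)) else 0 with hp
  have hp0 : ∀ i, 0 ≤ p i := by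
    intro i
    simp only [hp]
    split_ifs
    · exact le_min zero_le_one (div_nonneg (hw i) (hb0 _).le)
    · exact le_rfl
  have hp1 : ∀ i, p i ≤ 1 := by
    intro i
    simp only [hp]
    split_ifs
    · exact min_le_left _ _
    · exact zero_le_one
  have hpA0 : ∀ i ∈ A 0, w i = 0 := by
    intro i hi
    rw [hA0] at hi
    exact (mem_filter.1 hi).2
  have hkA : ∀ j, (chainHeight F (A j) univ) ≤ k := fun j =>
    (chainHeight_anti F univ (empty_subset _)).trans hk
  have hcardA0 : #(univ \ A 0) ≤ n := by
    refine (card_le_card fun i hi => ?_).trans hn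
    rw [mem_sdiff, hA0] at hi
    simpa using hi.2
  have hcardA : ∀ j, #(univ \ A j) ≤ n := fun j =>
    (card_le_card (sdiff_subset_sdiff le_rfl (hmono (Nat.zero_le j)))).trans hcardA0
  -- the expected number of sampled elements
  have hpsum : ∑ i, p i ≤ 2 * ρ * k := by
    have h1 : ∑ i, p i = ∑ i ∈ univ ∩ A J, p i := by
      rw [univ_inter]
      exact (sum_subset (subset_univ _) fun i _ hi => by simp only [hp, if_neg hi]).symm
    have h2 : ∑ i ∈ univ ∩ A 0, p i = 0 := by
      refine sum_eq_zero fun i hi => ?_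
      simp [hp, hpA0 i (mem_inter.1 hi).2]
    rw [h1, sum_inter_telescope hmono, h2, zero_add]
    -- The factor 2 arises because block `j` is sampled at scale `2 ^ j` while its weight is bounded
    -- at scale `2 ^ (j + 1)`.
    have h3 : ∀ j ∈ range J, ∑ i ∈ univ ∩ (A (j + 1) \ A j), p i ≤
        2 * ρ * ((chainHeight F (A 0) (A (j + 1)) : ℝ) - chainHeight F (A 0) (A j)) := by
      intro j _
      rw [univ_inter]
      calc ∑ i ∈ A (j + 1) \ A j, p i ≤ ∑ i ∈ A (j + 1) \ A j, w i * (ρ / (d * 2 ^ j)) := by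
            refine sum_le_sum fun i hi => ?_
            simp only [hp]
            split_ifs
            · refine (min_le_right _ _).trans (le_of_eq ?_)
              rw [hlev j i hi]
              simp only [hb]
              field_simp
            · exact mul_nonneg (hw i) (by positivity)
        _ = (∑ i ∈ A (j + 1) \ A j, w i) * (ρ / (d * 2 ^ j)) := (sum_mul _ _ _).symm
        _ ≤ d * 2 ^ (j + 1) * (chainHeight F (A 0) (A (j + 1)) - chainHeight F (A 0) (A j)) *
            (ρ / (d * 2 ^ j)) := by
          gcongr
          exact hblock j
        _ = _ := by
          field_simp
          ring
    refine (sum_le_sum h3).trans ?_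
    rw [← mul_sum, sum_range_sub (fun j => (chainHeight F (A 0) (A j) : ℝ))]
    have h4 : (chainHeight F (A 0) (A J) : ℝ) ≤ k := by
      exact_mod_cast (chainHeight_mono F (A 0) fun c _ _ => subset_univ c).trans (hkA 0)
    gcongr
    linarith [Nat.cast_nonneg (α := ℝ) (chainHeight F (A 0) (A 0))]
  set lam : ℕ → ℝ := fun j => ε / b j with hlam
  have hlam0 : ∀ j, 0 < lam j := fun j => div_pos hε (hb0 j)
  -- `J` is not controlled by `n`, but the number of nonempty blocks is, since they are disjoint and
  -- avoid `A 0`.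
  set Js := (range J).filter fun j => ¬ A (j + 1) ⊆ A j with hJs
  have hJscard : (#Js : ℝ) ≤ n := by
    have h1 := sum_inter_telescope hmono (univ \ A 0) (fun _ => (1 : ℝ)) J
    have h2 : ∑ _i ∈ (univ \ A 0) ∩ A 0, (1 : ℝ) = 0 := by
      rw [sdiff_inter_self, sum_empty]
    have h3 : ∑ _i ∈ (univ \ A 0) ∩ A J, (1 : ℝ) ≤ n := by
      rw [sum_const, nsmul_one]
      exact_mod_cast (card_le_card inter_subset_left).trans hcardA0
    have h4 : (#Js : ℝ) ≤
        ∑ j ∈ range J, ∑ _i ∈ (univ \ A 0) ∩ (A (j + 1) \ A j), (1 : ℝ) := by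
      rw [← nsmul_one, ← sum_const]
      refine (sum_le_sum fun j hj => ?_).trans
        (sum_le_sum_of_subset_of_nonneg (filter_subset _ _) fun j _ _ =>
          sum_nonneg fun _ _ => zero_le_one)
      obtain ⟨i, hi, hi'⟩ := not_subset.1 (mem_filter.1 hj).2
      rw [sum_const, nsmul_one, Nat.one_le_cast]
      refine card_pos.2 ⟨i, mem_inter.2 ⟨mem_sdiff.2 ⟨mem_univ _, fun h => ?_⟩,
        mem_sdiff.2 ⟨hi, hi'⟩⟩⟩
      exact hi' (hmono (Nat.zero_le j) h)
    linarith
  let R : ℕ → Finset (Finset ι) := fun j => (words F (A j) univ).filter (·.Nonempty)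
  -- `none` stands for the sample-size constraint; `some ⟨j, (r, σ)⟩` for the deviation of `r` in
  -- block `j` in the direction `σ`.
  let T : Finset (Option (Σ _ : ℕ, Finset ι × ℝ)) :=
    insertNone (Js.sigma fun j => R j ×ˢ ({1, -1} : Finset ℝ))
  let u₁ : Option (Σ _ : ℕ, Finset ι × ℝ) → ι → ℝ := fun t i => t.elim 1 fun x =>
    if i ∈ x.2.1 ∩ A (x.1 + 1) then x.2.2 * lam x.1 * (w i / p i - w i) else 0
  let u₀ : Option (Σ _ : ℕ, Finset ι × ℝ) → ι → ℝ := fun t i => t.elim 0 fun x =>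
    if i ∈ x.2.1 ∩ A (x.1 + 1) then x.2.2 * lam x.1 * (0 - w i) else 0
  let v : Option (Σ _ : ℕ, Finset ι × ℝ) → ι → ℝ := fun t i => t.elim (2 * p i) fun x =>
    if i ∈ x.2.1 ∩ A (x.1 + 1) then lam x.1 * ε * w i else 0
  -- The first term cancels the sum of `v`; by the choice of `ρ`, the second leaves exactly the
  -- exponent of `sum_exp_neg_word_le`.
  let β : Option (Σ _ : ℕ, Finset ι × ℝ) → ℝ := fun t => t.elim (4 * ρ * k + 1) fun x =>
    lam x.1 * (ε * ∑ i ∈ x.2.1 ∩ A (x.1 + 1), w i +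
      ε / L * min (∑ i ∈ x.2.1, w i) (k * (d * 2 ^ x.1)))
  obtain ⟨S, hS⟩ : ∃ S : Finset ι, ∀ t ∈ T, ∑ i, (if i ∈ S then u₁ t i else u₀ t i) ≤ β t := by
    refine exists_sample T p hp0 hp1 u₁ u₀ v β ?_ ?_
    · intro t ht i
      rcases t with _ | ⟨j, r, σ⟩
      · simp only [u₁, u₀, v, Option.elim_none, Real.exp_zero, mul_one]
        have h1 := Real.add_one_le_exp (2 * p i)
        have h2 := Real.exp_one_lt_d9
        nlinarith [hp0 i]
      · simp only [T, some_mem_insertNone, mem_sigma, mem_product, R, Js, mem_filter,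
          mem_range, mem_insert, mem_singleton] at ht
        obtain ⟨⟨hj, -⟩, ⟨hr, -⟩, hσ⟩ := ht
        simp only [u₁, u₀, v, Option.elim_some]
        split_ifs with hi
        · obtain ⟨c, hc, -, rfl⟩ := mem_words.1 hr
          rw [mem_inter, mem_sdiff] at hi
          have hl : lev i = j := hlev j i (mem_sdiff.2 ⟨hi.2, hi.1.2⟩)
          have hpi : p i = min 1 (w i / b j) := by
            simp only [hp, if_pos (hJ c hc hi.1.1), hl]
          rw [hpi]
          exact bernoulli_exp_moment_le (hw i) (hb0 j) hε.le hε1 hσ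
        · simp
    · rw [sum_insertNone, sum_sigma]
      have h1 : Real.exp (∑ i, v none i - β none) ≤ 1 / 2 := by
        simp only [v, β, Option.elim_none, ← mul_sum]
        have h2 : 2 * ∑ i, p i - (4 * ρ * k + 1) ≤ -1 := by linarith
        refine (Real.exp_le_exp.2 h2).trans ?_
        linarith [Real.exp_neg_one_lt_d9]
      have h2 : ∀ j ∈ Js, ∑ x ∈ R j ×ˢ ({1, -1} : Finset ℝ),
          Real.exp (∑ i, v (some ⟨j, x⟩) i - β (some ⟨j, x⟩)) ≤
            2 * (3 * (((n : ℝ) + 2) ^ 6)⁻¹) := by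
        intro j _
        have h3 : ∀ r : Finset ι, ∀ σ : ℝ,
            Real.exp (∑ i, v (some ⟨j, (r, σ)⟩) i - β (some ⟨j, (r, σ)⟩)) =
            Real.exp (-(20 * Real.log (n + 2) *
              min ((∑ i ∈ r, w i) / (d * 2 ^ j)) k)) := by
          intro r σ
          congr 1
          simp only [v, β, Option.elim_some]
          rw [← sum_filter, filter_mem_eq_inter, univ_inter, ← mul_sum]
          have h4 : min ((∑ i ∈ r, w i) / (d * 2 ^ j)) (k : ℝ) =
              min (∑ i ∈ r, w i) (k * (d * 2 ^ j)) / (d * 2 ^ j) := by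
            rw [← min_div_div_right (hD j).le, mul_div_assoc, div_self (hD j).ne', mul_one]
          rw [h4]
          simp only [hlam, hb, hρ]
          field_simp
          ring
        rw [sum_product]
        simp only [h3, sum_const]
        have h5 : #({1, -1} : Finset ℝ) = 2 := card_pair (by norm_num)
        rw [h5, ← smul_sum, nsmul_eq_mul, Nat.cast_ofNat]
        gcongr
        exact sum_exp_neg_word_le hw (hD j) (hdense j) (hcardA j) (hkA j) hk1
      have h6 : (n : ℝ) * (2 * (3 * (((n : ℝ) + 2) ^ 6)⁻¹)) < 1 / 2 := by
        have hn0 : (0 : ℝ) ≤ n := Nat.cast_nonneg n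
        have h7 : (2 : ℝ) ^ 5 ≤ ((n : ℝ) + 2) ^ 5 := by
          gcongr
          linarith
        rw [← div_eq_mul_inv, ← mul_div_assoc, ← mul_div_assoc, div_lt_iff₀ (by positivity)]
        nlinarith
      have h7 := sum_le_card_nsmul Js _ _ h2
      rw [nsmul_eq_mul] at h7
      have h8 : (#Js : ℝ) * (2 * (3 * (((n : ℝ) + 2) ^ 6)⁻¹)) ≤
          n * (2 * (3 * (((n : ℝ) + 2) ^ 6)⁻¹)) := by gcongr
      linarith
  set w' : ι → ℝ := fun i => if i ∈ S then w i / p i else 0 with hw'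
  have herr : ∀ c ∈ F, ∀ j ∈ range J,
      |∑ i ∈ c ∩ (A (j + 1) \ A j), (w' i - w i)| ≤
        ε * ∑ i ∈ c ∩ (A (j + 1) \ A j), w i +
        ε / L * if c ⊆ A j then 0 else min (∑ i ∈ c, w i) (k * (d * 2 ^ j)) := by
    intro c hc j hj
    by_cases hcj : c ⊆ A j
    · have h1 : c ∩ (A (j + 1) \ A j) = ∅ := by
        rw [eq_empty_iff_forall_notMem]
        intro i hi
        rw [mem_inter, mem_sdiff] at hi
        exact hi.2.2 (hcj hi.1)
      simp [h1, hcj]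
    by_cases hAj : A (j + 1) ⊆ A j
    · have h1 : c ∩ (A (j + 1) \ A j) = ∅ := by
        rw [sdiff_eq_empty_iff_subset.2 hAj, inter_empty]
      rw [h1, if_neg hcj]
      simp only [sum_empty, abs_zero, mul_zero, zero_add]
      have : 0 ≤ min (∑ i ∈ c, w i) (k * (d * 2 ^ j)) :=
        le_min (sum_nonneg fun i _ => hw i) (by positivity)
      positivity
    rw [if_neg hcj]
    have hinter : (c \ A j) ∩ A (j + 1) = c ∩ (A (j + 1) \ A j) := by
      ext i
      simp only [mem_inter, mem_sdiff]
      tauto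
    have hr : c \ A j ∈ R j := mem_filter.2 ⟨mem_words.2 ⟨c, hc, subset_univ c, rfl⟩, by
      rwa [nonempty_iff_ne_empty, Ne, sdiff_eq_empty_iff_subset]⟩
    have hσ : ∀ σ ∈ ({1, -1} : Finset ℝ), σ * ∑ i ∈ c ∩ (A (j + 1) \ A j), (w' i - w i) ≤
        ε * ∑ i ∈ c ∩ (A (j + 1) \ A j), w i +
        ε / L * min (∑ i ∈ c, w i) (k * (d * 2 ^ j)) := by
      intro σ hσ
      have h1 := hS (some ⟨j, (c \ A j, σ)⟩) (some_mem_insertNone.2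
        (mem_sigma.2 ⟨mem_filter.2 ⟨hj, hAj⟩, mem_product.2 ⟨hr, hσ⟩⟩))
      have h2 : ∑ i, (if i ∈ S then u₁ (some ⟨j, (c \ A j, σ)⟩) i
          else u₀ (some ⟨j, (c \ A j, σ)⟩) i) =
          lam j * (σ * ∑ i ∈ c ∩ (A (j + 1) \ A j), (w' i - w i)) := by
        rw [mul_sum, mul_sum, ← hinter, ← univ_inter ((c \ A j) ∩ A (j + 1)),
          ← filter_mem_eq_inter, sum_filter]
        refine sum_congr rfl fun i _ => ?_
        simp only [u₁, u₀, Option.elim_some, hw']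
        split_ifs <;> ring
      rw [h2] at h1
      simp only [β, Option.elim_some, hinter] at h1
      refine (le_of_mul_le_mul_left h1 (hlam0 j)).trans ?_
      gcongr
      · exact fun i _ _ => hw i
      · exact sdiff_subset
    rw [abs_le']
    exact ⟨by simpa using hσ 1 (by simp), by simpa using hσ (-1) (by simp)⟩
  refine ⟨w', fun i => ?_, fun c hc => ?_, ?_⟩
  · simp only [hw']
    split_ifs
    · exact div_nonneg (hw i) (hp0 i)
    · exact le_rfl
  · have hcJ : c ∩ A J = c := inter_eq_left.2 (hJ c hc)
    have h1 := sum_inter_telescope hmono c (fun i => w' i - w i) J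
    have h2 := sum_inter_telescope hmono c w J
    have h3 : ∑ i ∈ c ∩ A 0, (w' i - w i) = 0 := by
      refine sum_eq_zero fun i hi => ?_
      simp [hw', hpA0 i (mem_inter.1 hi).2]
    have h4 : ∑ i ∈ c ∩ A 0, w i = 0 := sum_eq_zero fun i hi => hpA0 i (mem_inter.1 hi).2
    rw [hcJ, h3, zero_add, sum_sub_distrib] at h1
    rw [hcJ, h4, zero_add] at h2
    have hy : 0 ≤ ∑ i ∈ c, w i := sum_nonneg fun i _ => hw i
    have h5 : ∑ j ∈ range J, (if c ⊆ A j then 0 else min (∑ i ∈ c, w i) (k * (d * 2 ^ j))) ≤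
        L * ∑ i ∈ c, w i := by
      set I := (range J).filter fun j => ¬ c ⊆ A j with hI
      have h6 : ∑ j ∈ range J,
          (if c ⊆ A j then 0 else min (∑ i ∈ c, w i) (k * (d * 2 ^ j))) =
          ∑ j ∈ I, min (∑ i ∈ c, w i) (k * (d * 2 ^ j)) := by
        rw [hI, sum_filter]
        simp only [ite_not]
      rw [h6]
      -- Only scales with `c` not inside `A j` contribute, and at the largest of them density gives
      -- `d * 2 ^ j ≤ w(c)`.
      rcases I.eq_empty_or_nonempty with hI0 | hI0
      · rw [hI0, sum_empty]
        positivity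
      have hM := mem_filter.1 (max'_mem I hI0)
      have h7 : d * 2 ^ (I.max' hI0) ≤ ∑ i ∈ c, w i :=
        ((hdense _).le_sum_word (hD _).le hc hM.2).trans
          (sum_le_sum_of_subset_of_nonneg sdiff_subset fun i _ _ => hw i)
      refine le_trans (sum_le_sum_of_subset_of_nonneg (fun j hj => ?_) fun j _ _ => ?_)
        (sum_min_geometric_le hd (Nat.clog 2 k) ?_ _ h7)
      · exact mem_range.2 (Nat.lt_succ_of_le (le_max' I j hj))
      · exact le_min hy (by positivity)
      · exact_mod_cast Nat.le_pow_clog (by norm_num) k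
    rw [h1]
    refine (abs_sum_le_sum_abs _ _).trans ((sum_le_sum (herr c hc)).trans ?_)
    rw [sum_add_distrib, ← mul_sum, ← mul_sum, ← h2]
    have h8 : ε / L * ∑ j ∈ range J,
        (if c ⊆ A j then 0 else min (∑ i ∈ c, w i) (k * (d * 2 ^ j))) ≤
        ε / L * (L * ∑ i ∈ c, w i) := by gcongr
    have h9 : ε / L * (L * ∑ i ∈ c, w i) = ε * ∑ i ∈ c, w i := by field_simp
    linarith
  · have h1 := hS none (by simp [T])
    simp only [u₁, u₀, β, Option.elim_none] at h1
    rw [← sum_filter, filter_mem_eq_inter, univ_inter, sum_const, nsmul_one] at h1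
    have h2 : #(univ.filter (w' · ≠ 0)) ≤ #S := by
      refine card_le_card fun i hi => ?_
      by_contra hiS
      simp [hw', hiS] at hi
    calc (#(univ.filter (w' · ≠ 0)) : ℝ) ≤ #S := by exact_mod_cast h2
      _ ≤ _ := h1.trans (le_of_eq (by ring))

end CodeSparsifier

/-! ### Iteration, removing the dependence on the support size -/

namespace CodeSparsifier
open Finset

variable {ι : Type*}

/-- The weights `w` and `w'` of every word of `F` agree up to a factor `exp s`. -/
def IsApprox (F : Finset (Finset ι)) (w w' : ι → ℝ) (s : ℝ) : Prop :=
  ∀ c ∈ F, ∑ i ∈ c, w' i ≤ Real.exp s * ∑ i ∈ c, w i ∧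
    ∑ i ∈ c, w i ≤ Real.exp s * ∑ i ∈ c, w' i

theorem IsApprox.trans {F : Finset (Finset ι)} {w w' w'' : ι → ℝ} {s s' : ℝ}
    (h : IsApprox F w w' s) (h' : IsApprox F w' w'' s') : IsApprox F w w'' (s + s') := by
  intro c hc
  obtain ⟨h1, h2⟩ := h c hc
  obtain ⟨h3, h4⟩ := h' c hc
  rw [Real.exp_add]
  constructor
  · calc _ ≤ _ := h3
      _ ≤ Real.exp s' * (Real.exp s * ∑ i ∈ c, w i) := by gcongr
      _ = _ := by ring
  · calc _ ≤ _ := h2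
      _ ≤ Real.exp s * (Real.exp s' * ∑ i ∈ c, w'' i) := by gcongr
      _ = _ := by ring

variable [DecidableEq ι]

theorem exists_isApprox_of_card_le [Fintype ι] (F : Finset (Finset ι)) {w : ι → ℝ}
    (hw : ∀ i, 0 ≤ w i) {k n : ℕ} (hk : chainHeight F ∅ univ ≤ k) (hk1 : 1 ≤ k)
    (hn : #(univ.filter (w · ≠ 0)) ≤ n) {η : ℝ} (hη : 0 < η) (hη1 : η ≤ 1 / 2) :
    ∃ w' : ι → ℝ, (∀ i, 0 ≤ w' i) ∧ IsApprox F w w' (2 * η) ∧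
      (#(univ.filter (w' · ≠ 0)) : ℝ) ≤
        330 * k * (Nat.clog 2 k + 2) * Real.log (n + 2) / η ^ 2 := by
  obtain ⟨w', hw', herr, hcard⟩ := exists_sparsifier_of_card_le F hw hk hk1 hn
    (ε := η / 2) (by positivity) (by linarith)
  refine ⟨w', hw', fun c hc => ?_, hcard.trans ?_⟩
  · have h1 := abs_le.1 (herr c hc)
    have h2 := Real.add_one_le_exp (2 * η)
    have h3 : 0 ≤ ∑ i ∈ c, w i := sum_nonneg fun i _ => hw i
    have h4 : 0 ≤ ∑ i ∈ c, w' i := sum_nonneg fun i _ => hw' i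
    constructor
    · calc ∑ i ∈ c, w' i ≤ (2 * η + 1) * ∑ i ∈ c, w i := by nlinarith
        _ ≤ _ := by gcongr
    · calc ∑ i ∈ c, w i ≤ (2 * η + 1) * ((1 - η) * ∑ i ∈ c, w i) := by
            rw [← mul_assoc]
            exact le_mul_of_one_le_left h3 (by nlinarith)
        _ ≤ (2 * η + 1) * ∑ i ∈ c, w' i := by
          gcongr
          linarith
        _ ≤ _ := by gcongr
  · have hk' : (1 : ℝ) ≤ k := by exact_mod_cast hk1
    have hL : (2 : ℝ) ≤ Nat.clog 2 k + 2 := by linarith [Nat.cast_nonneg (α := ℝ) (Nat.clog 2 k)]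
    have hlog : 1 / 2 ≤ Real.log (n + 2) := by
      have : Real.log 2 ≤ Real.log (n + 2) :=
        Real.log_le_log two_pos (by linarith [Nat.cast_nonneg (α := ℝ) n])
      linarith [Real.log_two_gt_d9]
    have h1 : 1 ≤ k * (Nat.clog 2 k + 2) * Real.log (n + 2) / η ^ 2 := by
      rw [le_div_iff₀ (by positivity)]
      calc 1 * η ^ 2 ≤ 1 * 2 * (1 / 2) := by nlinarith
        _ ≤ _ := by gcongr
    calc 4 * (20 * (Nat.clog 2 k + 2) * Real.log (n + 2) / (η / 2) ^ 2) * k + 1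
        = 320 * (k * (Nat.clog 2 k + 2) * Real.log (n + 2) / η ^ 2) + 1 := by
          field_simp
          ring
      _ ≤ 330 * (k * (Nat.clog 2 k + 2) * Real.log (n + 2) / η ^ 2) := by linarith
      _ = _ := by ring

/-- Each round divides the support bound by 16. The finest accuracy `η / 2 ^ t` is used first: its
cost, a factor `4 ^ t`, and the logarithm, at most `7 * M * 4 ^ t`, together fit into `16 ^ t`. The
errors form a geometric series. -/
theorem exists_isApprox_card_le_pow [Fintype ι] (F : Finset (Finset ι)) {k M : ℕ}
    (hk : chainHeight F ∅ univ ≤ k) (hk1 : 1 ≤ k) {η : ℝ} (hη : 0 < η) (hη1 : η ≤ 1 / 2)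
    (hM : 28 * (330 * k * (Nat.clog 2 k + 2)) / η ^ 2 ≤ M) (t : ℕ) {w : ι → ℝ}
    (hw : ∀ i, 0 ≤ w i) (hn : #(univ.filter (w · ≠ 0)) ≤ M ^ 2 * 16 ^ t) :
    ∃ w' : ι → ℝ, (∀ i, 0 ≤ w' i) ∧ IsApprox F w w' (2 * η * (1 - 1 / 2 ^ t)) ∧
      #(univ.filter (w' · ≠ 0)) ≤ M ^ 2 := by
  induction t generalizing w with
  | zero => exact ⟨w, hw, fun c _ => by simp, by simpa using hn⟩
  | succ t ih =>
    have hη' : η / 2 ^ (t + 1) ≤ 1 / 2 :=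
      (div_le_self hη.le (one_le_pow₀ one_le_two)).trans hη1
    obtain ⟨w', hw', happ, hcard⟩ := exists_isApprox_of_card_le F hw hk hk1 hn
      (η := η / 2 ^ (t + 1)) (by positivity) hη'
    set a : ℝ := 330 * k * (Nat.clog 2 k + 2) with ha
    have hk' : (1 : ℝ) ≤ k := by exact_mod_cast hk1
    have ha0 : 0 < a := by positivity
    have hM0 : (0 : ℝ) < M := lt_of_lt_of_le (by positivity) hM
    have hM1 : (1 : ℝ) ≤ M := by exact_mod_cast hM0
    have hlog : Real.log (((M ^ 2 * 16 ^ (t + 1) : ℕ) : ℝ) + 2) ≤ 7 * M * 4 ^ t := by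
      have h16 : (1 : ℝ) ≤ 16 ^ (t + 1) := one_le_pow₀ (by norm_num)
      have h1 : ((M ^ 2 * 16 ^ (t + 1) : ℕ) : ℝ) + 2 ≤ ((M : ℝ) + 2) ^ 2 * 16 ^ (t + 1) := by
        push_cast
        nlinarith
      have ht : ((t + 1 : ℕ) : ℝ) ≤ 4 ^ t := by
        exact_mod_cast Nat.lt_pow_self (n := t) (a := 4) (by norm_num)
      have h4 : Real.log 16 ≤ 3 := by
        rw [show (16 : ℝ) = 2 ^ 4 by norm_num, Real.log_pow]
        have := Real.log_two_lt_d9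
        push_cast
        linarith
      have h5 : Real.log ((M : ℝ) + 2) ≤ M + 1 := by
        linarith [Real.log_le_sub_one_of_pos (show (0 : ℝ) < M + 2 by positivity)]
      have h6 : (1 : ℝ) ≤ 4 ^ t := one_le_pow₀ (by norm_num)
      calc Real.log (((M ^ 2 * 16 ^ (t + 1) : ℕ) : ℝ) + 2)
          ≤ Real.log (((M : ℝ) + 2) ^ 2 * 16 ^ (t + 1)) :=
            Real.log_le_log (by positivity) h1
        _ = 2 * Real.log ((M : ℝ) + 2) + ((t + 1 : ℕ) : ℝ) * Real.log 16 := by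
          rw [Real.log_mul (by positivity) (by positivity), Real.log_pow, Real.log_pow]
          push_cast
          ring
        _ ≤ 2 * (M + 1) + 4 ^ t * 3 := by gcongr
        _ ≤ 7 * M * 4 ^ t := by nlinarith
    have hcard' : #(univ.filter (w' · ≠ 0)) ≤ M ^ 2 * 16 ^ t := by
      have : (#(univ.filter (w' · ≠ 0)) : ℝ) ≤ M ^ 2 * 16 ^ t := by
        refine hcard.trans ?_
        calc a * Real.log (((M ^ 2 * 16 ^ (t + 1) : ℕ) : ℝ) + 2) / (η / 2 ^ (t + 1)) ^ 2
            ≤ a * (7 * M * 4 ^ t) / (η / 2 ^ (t + 1)) ^ 2 := by gcongr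
          _ = 28 * a / η ^ 2 * (M * 16 ^ t) := by
            have h2 : ((2 : ℝ) ^ (t + 1)) ^ 2 = 4 * 4 ^ t := by
              rw [← pow_mul, mul_comm, pow_mul, pow_succ]
              norm_num
              ring
            have h3 : (16 : ℝ) ^ t = 4 ^ t * 4 ^ t := by
              rw [← mul_pow]
              norm_num
            rw [div_pow, h2, h3]
            field_simp
            ring
          _ ≤ M * (M * 16 ^ t) := by gcongr
          _ = M ^ 2 * 16 ^ t := by ring
      exact_mod_cast this
    obtain ⟨w'', hw'', happ', hcard''⟩ := ih hw' hcard'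
    refine ⟨w'', hw'', ?_, hcard''⟩
    have := happ.trans happ'
    have hs : 2 * (η / 2 ^ (t + 1)) + 2 * η * (1 - 1 / 2 ^ t) =
        2 * η * (1 - 1 / 2 ^ (t + 1)) := by
      field_simp
      ring
    rwa [hs] at this

theorem clog_two_add_two_le_log {k : ℕ} (hk1 : 1 ≤ k) {X : ℝ} (hX : 4 ≤ X) (hkX : k ≤ X) :
    (Nat.clog 2 k : ℝ) + 2 ≤ 5 * Real.log X := by
  have h1 : (2 : ℝ) ^ Nat.clog 2 k ≤ 2 * X := by
    rcases Nat.lt_or_ge 1 k with hk | hk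
    · have h2 := Nat.pow_pred_clog_lt_self (b := 2) (by norm_num) hk
      have h3 : 0 < Nat.clog 2 k := Nat.clog_pos (by norm_num) hk
      obtain ⟨c, hc⟩ := Nat.exists_eq_succ_of_ne_zero h3.ne'
      rw [hc, Nat.pred_succ] at h2
      have h4 : (2 : ℝ) ^ c ≤ k := by exact_mod_cast h2.le
      rw [hc, pow_succ]
      linarith
    · have : k = 1 := by omega
      subst this
      simp
      linarith
  have h2 : ((Nat.clog 2 k : ℝ) + 2) * Real.log 2 ≤ 3 * Real.log X := by
    calc ((Nat.clog 2 k : ℝ) + 2) * Real.log 2 = Real.log (2 ^ (Nat.clog 2 k + 2)) := by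
          rw [Real.log_pow]
          push_cast
          ring
      _ ≤ Real.log (X ^ 3) := by
        refine Real.log_le_log (by positivity) ?_
        have hX2 : (4 : ℝ) ^ 2 ≤ X ^ 2 := by gcongr
        calc (2 : ℝ) ^ (Nat.clog 2 k + 2) = 2 ^ Nat.clog 2 k * 4 := by
              rw [pow_add]
              norm_num
          _ ≤ 2 * X * 4 := by gcongr
          _ ≤ X ^ 2 * X := by nlinarith
          _ = X ^ 3 := by ring
      _ = _ := by
        rw [Real.log_pow]
        norm_num
  have h3 := Real.log_two_gt_d9
  have h4 : 0 ≤ (Nat.clog 2 k : ℝ) + 2 := by positivity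
  nlinarith

theorem exists_isApprox [Fintype ι] (F : Finset (Finset ι)) {w : ι → ℝ} (hw : ∀ i, 0 ≤ w i)
    {k : ℕ} (hk : chainHeight F ∅ univ ≤ k) (hk1 : 1 ≤ k) {ε : ℝ} (hε : 0 < ε) (hε1 : ε ≤ 1)
    {X : ℝ} (hX : 4 ≤ X) (hkX : k / ε ≤ X) :
    ∃ w' : ι → ℝ, (∀ i, 0 ≤ w' i) ∧ IsApprox F w w' (ε / 2) ∧
      (#(univ.filter (w' · ≠ 0)) : ℝ) ≤ 2745600 * (k * Real.log X ^ 2 / ε ^ 2) := by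
  have hk' : (1 : ℝ) ≤ k := by exact_mod_cast hk1
  have hη : 0 < ε / 8 := by positivity
  have hη1 : ε / 8 ≤ 1 / 2 := by linarith
  have hL := clog_two_add_two_le_log hk1 hX ((le_div_self (by positivity) hε hε1).trans hkX)
  have hlogX : 0 ≤ Real.log X := Real.log_nonneg (by linarith)
  set M := ⌈28 * (330 * k * (Nat.clog 2 k + 2)) / (ε / 8) ^ 2⌉₊ with hM
  have hML : 28 * (330 * k * (Nat.clog 2 k + 2)) / (ε / 8) ^ 2 ≤ (M : ℝ) := Nat.le_ceil _
  have hM1 : 1 ≤ M := Nat.one_le_ceil_iff.2 (by positivity)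
  -- `M` is `O(X ^ 2)`, and `X ≥ 4` lets `X ^ 11` absorb the constant.
  have hMX : (M : ℝ) + 2 ≤ X ^ 13 := by
    have h1 : (M : ℝ) < 28 * (330 * k * (Nat.clog 2 k + 2)) / (ε / 8) ^ 2 + 1 :=
      Nat.ceil_lt_add_one (by positivity)
    have h2 : (Nat.clog 2 k : ℝ) ≤ k := by
      exact_mod_cast Nat.clog_le_of_le_pow (Nat.lt_two_pow_self).le
    have h3 : 28 * (330 * k * (Nat.clog 2 k + 2)) / (ε / 8) ^ 2 ≤ 1774080 * X ^ 2 := by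
      calc 28 * (330 * k * (Nat.clog 2 k + 2)) / (ε / 8) ^ 2
          ≤ 28 * (330 * k * (3 * k)) / (ε / 8) ^ 2 := by
            gcongr
            linarith
        _ = 1774080 * (k / ε) ^ 2 := by
          field_simp
          ring
        _ ≤ _ := by gcongr
    have h4 : (4 : ℝ) ^ 11 * X ^ 2 ≤ X ^ 13 := by
      rw [show 13 = 11 + 2 by norm_num, pow_add X]
      gcongr
    norm_num at h4
    nlinarith
  have hcard0 : #(univ.filter (w · ≠ 0)) ≤ M ^ 2 * 16 ^ Fintype.card ι := by
    calc _ ≤ Fintype.card ι := card_le_univ _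
      _ ≤ 16 ^ Fintype.card ι := (Nat.lt_pow_self (by norm_num)).le
      _ ≤ _ := Nat.le_mul_of_pos_left _ (by positivity)
  obtain ⟨w₁, hw₁, happ₁, hcard₁⟩ :=
    exists_isApprox_card_le_pow F hk hk1 hη hη1 hML _ hw hcard0
  -- With support at most `M ^ 2`, a final round has `log n = O(log X)`. The iteration and this
  -- round each cost at most `2 * (ε / 8)`.
  obtain ⟨w₂, hw₂, happ₂, hcard₂⟩ := exists_isApprox_of_card_le F hw₁ hk hk1 hcard₁ hη hη1
  refine ⟨w₂, hw₂, fun c hc => ?_, hcard₂.trans ?_⟩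
  · have h1 := happ₁.trans happ₂ c hc
    have h2 : 2 * (ε / 8) * (1 - 1 / 2 ^ Fintype.card ι) + 2 * (ε / 8) ≤ ε / 2 := by
      have : (0 : ℝ) ≤ 1 / 2 ^ Fintype.card ι := by positivity
      nlinarith
    have h3 := Real.exp_le_exp.2 h2
    exact ⟨h1.1.trans (mul_le_mul_of_nonneg_right h3 (sum_nonneg fun i _ => hw i)),
      h1.2.trans (mul_le_mul_of_nonneg_right h3 (sum_nonneg fun i _ => hw₂ i))⟩
  · have hlog : Real.log (((M ^ 2 : ℕ) : ℝ) + 2) ≤ 26 * Real.log X := by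
      calc Real.log (((M ^ 2 : ℕ) : ℝ) + 2) ≤ Real.log ((X ^ 13) ^ 2) := by
            refine Real.log_le_log (by positivity) ?_
            push_cast
            calc (M : ℝ) ^ 2 + 2 ≤ ((M : ℝ) + 2) ^ 2 := by nlinarith [Nat.cast_nonneg (α := ℝ) M]
              _ ≤ _ := by gcongr
        _ = _ := by
          rw [← pow_mul, Real.log_pow]
          norm_num
    have hlog0 : 0 ≤ Real.log (((M ^ 2 : ℕ) : ℝ) + 2) :=
      Real.log_nonneg (by linarith [Nat.cast_nonneg (α := ℝ) (M ^ 2)])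
    calc 330 * k * (Nat.clog 2 k + 2) * Real.log (((M ^ 2 : ℕ) : ℝ) + 2) / (ε / 8) ^ 2
        ≤ 330 * k * (5 * Real.log X) * (26 * Real.log X) / (ε / 8) ^ 2 := by gcongr
      _ = _ := by
        field_simp
        ring

/-! ### From codes to set families -/

/-- The support of a codeword. -/
def wordSupport {m : ℕ} (c : Fin m → Fin 2) : Finset (Fin m) := univ.filter (c · = 1)

theorem mem_wordSupport {m : ℕ} {c : Fin m → Fin 2} {i : Fin m} :
    i ∈ wordSupport c ↔ c i = 1 := by
  simp [wordSupport]

theorem codewordWeight_eq_sum {m : ℕ} (w : Fin m → ℝ≥0) (c : Fin m → Fin 2) :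
    codewordWeight w c = ∑ i ∈ wordSupport c, (w i : ℝ) := by
  rw [codewordWeight, wordSupport, sum_filter]
  refine sum_congr rfl fun i _ => ?_
  have : c i = 0 ∨ c i = 1 := by omega
  rcases this with h | h <;> simp [h]

open scoped Classical in
/-- The supports of the codewords of a code. -/
noncomputable def supports {m : ℕ} (C : Set (Fin m → Fin 2)) : Finset (Finset (Fin m)) :=
  (univ.filter (· ∈ C)).image wordSupport

theorem mem_supports {m : ℕ} {C : Set (Fin m → Fin 2)} {s : Finset (Fin m)} :
    s ∈ supports C ↔ ∃ c ∈ C, wordSupport c = s := by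
  simp [supports]

theorem HasChain.exists_sequences {m : ℕ} {C : Set (Fin m → Fin 2)} {B : Finset (Fin m)}
    {ℓ : ℕ} {A : Finset (Fin m)} (h : HasChain (supports C) B ℓ A) :
    ∃ (a : Fin ℓ → Fin m) (c : Fin ℓ → Fin m → Fin 2), (∀ i, c i ∈ C) ∧ (∀ i, a i ∉ A) ∧
      (∀ i, c i (a i) = 1) ∧ ∀ i j, i < j → c i (a j) = 0 := by
  induction ℓ generalizing A with
  | zero => exact ⟨fun i => i.elim0, fun i => i.elim0, fun i => i.elim0, fun i => i.elim0,
      fun i => i.elim0, fun i => i.elim0⟩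
  | succ ℓ ih =>
    obtain ⟨s, hs, -, hsA, h⟩ := h
    obtain ⟨c₀, hc₀, rfl⟩ := mem_supports.1 hs
    obtain ⟨i₀, hi₀, hi₀A⟩ := not_subset.1 hsA
    obtain ⟨a, c, hc, ha, hdiag, habove⟩ := ih h
    refine ⟨Fin.cons i₀ a, Fin.cons c₀ c, Fin.cases hc₀ hc,
      Fin.cases hi₀A fun i hi => ha i (mem_union_left _ hi),
      Fin.cases (mem_wordSupport.1 hi₀) hdiag, fun i j hij => ?_⟩
    induction j using Fin.cases with
    | zero => exact absurd hij (Fin.not_lt_zero i)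
    | succ j =>
      induction i using Fin.cases with
      | zero =>
        have h1 : ¬ c₀ (a j) = 1 := fun h1 =>
          ha j (mem_union_right _ (mem_wordSupport.2 h1))
        simp only [Fin.cons_zero, Fin.cons_succ]
        omega
      | succ i =>
        simp only [Fin.cons_succ]
        exact habove i j (Fin.succ_lt_succ_iff.1 hij)

theorem chainHeight_supports_le {m : ℕ} (C : Set (Fin m → Fin 2)) :
    chainHeight (supports C) ∅ univ ≤ chainLength C := by
  obtain ⟨a, c, hc, -, hdiag, habove⟩ :=
    (hasChain_chainHeight (supports C) ∅ univ).exists_sequences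
  refine (chainLength_isGreatest C).2 ⟨a, c, fun i j hij => ?_, fun i j hij => ?_, hc, hdiag,
    habove⟩
  · rcases lt_trichotomy i j with h | h | h
    · have := habove i j h
      rw [← hij, hdiag] at this
      exact absurd this one_ne_zero
    · exact h
    · have := habove j i h
      rw [hij, hdiag] at this
      exact absurd this one_ne_zero
  · rcases lt_trichotomy i j with h | h | h
    · have := habove i j h
      rw [hij, hdiag] at this
      exact absurd this one_ne_zero
    · exact h
    · have := habove j i h
      rw [← hij, hdiag] at this
      exact absurd this one_ne_zero

/-- `log 4 ≥ 4 / 3` keeps `log log X` at least `1 / 4`, so the factor `(log log X)²` can be inserted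
at the cost of a constant. -/
theorem one_le_sixteen_mul_log_log_sq {X : ℝ} (hX : 4 ≤ X) :
    1 ≤ 16 * Real.log (Real.log X) ^ 2 := by
  have h1 : 4 / 3 ≤ Real.log X := by
    have h2 : Real.log 4 ≤ Real.log X := Real.log_le_log (by norm_num) hX
    rw [show (4 : ℝ) = 2 ^ 2 by norm_num, Real.log_pow] at h2
    have := Real.log_two_gt_d9
    push_cast at h2
    linarith
  have h2 := Real.one_sub_inv_le_log_of_pos (show 0 < Real.log X by linarith)
  have h3 : (Real.log X)⁻¹ ≤ 3 / 4 := by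
    rw [inv_le_comm₀ (by linarith) (by norm_num)]
    linarith
  nlinarith

end CodeSparsifier

/-! ### The main theorem -/

open CodeSparsifier

theorem theorem1p2 :
    ∃ K : ℝ, 0 < K ∧
      ∀ (m : ℕ) (C : Set (Fin m → Fin 2)) (w : Fin m → ℝ≥0) (ε : ℝ), 0 < ε →
        ∃ w' : Fin m → ℝ≥0, IsCodeSparsifier C w ε w' ∧
          ((Function.support w').ncard : ℝ) ≤
            K * ((chainLength C : ℝ)
              * (Real.log (max 4 ((chainLength C : ℝ) / ε))) ^ 2
              * (Real.log (Real.log (max 4 ((chainLength C : ℝ) / ε)))) ^ 2 / ε ^ 2) := by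
  refine ⟨16 * 2745600, by norm_num, fun m C w ε hε => ?_⟩
  have hweight : ∀ c, 0 ≤ codewordWeight w c := fun c => by
    rw [codewordWeight_eq_sum]
    exact Finset.sum_nonneg fun i _ => (w i).2
  have hzero : ∀ c, codewordWeight (0 : Fin m → ℝ≥0) c = 0 := fun c => by
    simp [codewordWeight]
  set k := chainLength C with hk
  rcases le_or_gt 1 ε with hε1 | hε1
  -- For `ε ≥ 1` the lower bound is nonpositive, so zero weights suffice.
  · refine ⟨0, fun c _ => ?_, ?_⟩
    · rw [hzero]
      exact ⟨mul_nonpos_of_nonpos_of_nonneg (by linarith) (hweight c),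
        mul_nonneg (by linarith) (hweight c)⟩
    · simp only [Function.support_zero, Set.ncard_empty, Nat.cast_zero]
      positivity
  rcases Nat.eq_zero_or_pos k with hk0 | hk1
  · refine ⟨0, fun c hc => ?_, ?_⟩
    · have h1 : codewordWeight w c = 0 := by
        have h2 : wordSupport c ⊆ ∅ := by
          by_contra h
          have h3 := one_le_chainHeight (B := Finset.univ) (mem_supports.2 ⟨c, hc, rfl⟩)
            (Finset.subset_univ _) h
          have h4 := chainHeight_supports_le C
          omega
        rw [codewordWeight_eq_sum, Finset.subset_empty.1 h2, Finset.sum_empty]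
      rw [hzero, h1]
      simp
    · simp only [Function.support_zero, Set.ncard_empty, Nat.cast_zero]
      positivity
  set X : ℝ := max 4 (k / ε) with hX
  have hX4 : 4 ≤ X := le_max_left _ _
  obtain ⟨w', hw', happ, hcard⟩ := exists_isApprox (supports C) (w := fun i => (w i : ℝ))
    (fun i => (w i).2) (chainHeight_supports_le C) hk1 hε hε1.le hX4 (le_max_right _ _)
  have hcoe : ∀ i, ((w' i).toNNReal : ℝ) = w' i := fun i => Real.coe_toNNReal _ (hw' i)
  refine ⟨fun i => (w' i).toNNReal, fun c hc => ?_, ?_⟩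
  · have h1 := happ _ (mem_supports.2 ⟨c, hc, rfl⟩)
    have h2 := hweight c
    rw [codewordWeight_eq_sum] at h2
    simp only [codewordWeight_eq_sum, hcoe]
    have h3 := (abs_le.1 (Real.abs_exp_sub_one_sub_id_le (x := ε / 2)
      (by rw [abs_of_pos] <;> linarith))).2
    have h4 : Real.exp (ε / 2) ≤ 1 + ε := by nlinarith
    have h5 : 0 ≤ ∑ i ∈ wordSupport c, w' i := Finset.sum_nonneg fun i _ => hw' i
    refine ⟨?_, h1.1.trans (mul_le_mul_of_nonneg_right h4 h2)⟩
    -- Turns the symmetric multiplicative bound into the lower bound with factor `1 - ε`.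
    have h6 : (1 - ε) * (1 + ε) ≤ 1 := by nlinarith
    calc (1 - ε) * ∑ i ∈ wordSupport c, (w i : ℝ)
        ≤ (1 - ε) * ((1 + ε) * ∑ i ∈ wordSupport c, w' i) :=
          mul_le_mul_of_nonneg_left (h1.2.trans (mul_le_mul_of_nonneg_right h4 h5))
            (by linarith)
      _ = (1 - ε) * (1 + ε) * ∑ i ∈ wordSupport c, w' i := by ring
      _ ≤ ∑ i ∈ wordSupport c, w' i := mul_le_of_le_one_left h5 h6
  · have h1 : (Function.support fun i => (w' i).toNNReal) ⊆
        (Finset.univ.filter (w' · ≠ 0) : Finset (Fin m)) := by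
      intro i hi
      simp only [Finset.coe_filter, Finset.mem_univ, true_and, Set.mem_ofPred_eq]
      intro h
      simp [h] at hi
    have h2 := Set.ncard_le_ncard h1 (Finset.finite_toSet _)
    rw [Set.ncard_coe_finset] at h2
    have h3 : (0 : ℝ) ≤ k * Real.log X ^ 2 / ε ^ 2 := by positivity
    calc ((Function.support fun i => (w' i).toNNReal).ncard : ℝ)
        ≤ 2745600 * (k * Real.log X ^ 2 / ε ^ 2) := (Nat.cast_le.2 h2).trans hcard
      _ ≤ 2745600 * (k * Real.log X ^ 2 / ε ^ 2) * (16 * Real.log (Real.log X) ^ 2) :=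
        le_mul_of_one_le_right (by positivity) (one_le_sixteen_mul_log_log_sq hX4)
      _ = _ := by ring
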